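/- For $\theta\in\mathbb R$ let $\mathbb C_\theta=\{s\in\mathbb C:\operatorname{Re}s>\theta\}$. A *convergent Dirichlet series* is an analytic function $\varphi$ on $\mathbb C_0$ such that $\varphi(s)=\sum_{n\ge1}a_nn^{-s}$ for $\operatorname{Re}s$ large enough. The *Wiener algebra* $\mathcal A^+$ is the Banach space of all $f:\mathbb C_0\to\mathbb C$ of the form $f(s)=\sum_{n\ge1}a_nn^{-s}$ with $\|f\|_{\mathcal A^+}:=\sum_{n\ge1}|a_n|<\infty$. For $1\le p<\infty$, the *Hardy space* $\mathscr H^p$ is the set of all convergent Dirichlet series $\sum a_nn^{-s}$ whose Bohr lift $\sum_\alpha a_{n(\alpha)}z^\alpha$, with $n(\alpha)=\prod_jp_j^{\alpha_j}$ and $(p_j)$ the sequence of primes, belongs to $H^p(\mathbb T^\infty)$, i.e. is the Fourier series of a function in $L^p(\mathbb T^\infty)$ (with respect to normalized Haar measure) whose Fourier coefficients vanish at every index with a negative entry. A bounded linear operator $u:X\to Y$ between Banach spaces is *absolutely summing* ($1$-summing) if there is a constant $K>0$ such that $\sum_{k=1}^n\|u(x_k)\|\le K\sup_{\|\xi\|_{X^*}\le1}\sum_{k=1}^n|\xi(x_k)|$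 for all $n\ge1$ and $x_1,\dots,x_n\in X$. **Theorem.** There is a convergent Dirichlet series $\varphi$ with $\varphi(\mathbb C_0)\subseteq\mathbb C_0$ such that the composition operator $C_\varphi(f)=f\circ\varphi$ is a bounded operator from $\mathcal A^+$ to $\mathcal A^+$, although $\varphi\notin\mathcal A^+$. Moreover, $\varphi\in\mathscr H^p$ for all $1\le p<\infty$, and $C_\varphi$ is compact and absolutely summing. The function $\varphi$ can be taken of the form $\varphi(s)=f(2^{-s})$ for $\operatorname{Re}s>0$, where $f$ is a conformal map of the open unit disk onto the half-strip $\{z\in\mathbb C:\operatorname{Re}z>1,\ |\operatorname{Im}z|<\pi\}$. -/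

import Mathlib

/-- The open half-plane `{z : Re z > θ}`. -/
def rightHalfPlane (θ : ℝ) : Set ℂ := {z | θ < z.re}

/-- The general term `a_n n^{-s}` (`n ≥ 1`) of the Dirichlet series with coefficients `a`. -/
noncomputable def dirichletTerm (a : ℕ+ → ℂ) (s : ℂ) (n : ℕ+) : ℂ := a n * ((n : ℕ) : ℂ) ^ (-s)

/-- `f` is analytic on `{Re s > 0}` and is the sum of the Dirichlet series `∑ a_n n^{-s}` for
`Re s` large enough. (Convergence at one point `s₀` forces absolute convergence for
`Re s > Re s₀ + 1`, so that it does not matter that `HasSum` is unconditional convergence.) -/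
def HasDirichletSeries (f : ℂ → ℂ) (a : ℕ+ → ℂ) : Prop :=
  DifferentiableOn ℂ f (rightHalfPlane 0) ∧
    ∃ σ : ℝ, ∀ s : ℂ, σ < s.re → 0 < s.re → HasSum (dirichletTerm a s) (f s)

/-- `f` is a convergent Dirichlet series. -/
def IsConvergentDirichletSeries (f : ℂ → ℂ) : Prop := ∃ a : ℕ+ → ℂ, HasDirichletSeries f a

section Wiener

/-- The function `f` on `{Re s > 0}` is the sum there of the absolutely convergent Dirichlet
series with coefficients `a`, where `∑ |a_n| < ∞`. -/
def HasWienerSeries (f : rightHalfPlane 0 → ℂ) (a : ℕ+ → ℂ) : Prop :=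
  Summable (fun n => ‖a n‖) ∧ ∀ s : rightHalfPlane 0, HasSum (dirichletTerm a s) (f s)

theorem HasWienerSeries.add {f g : rightHalfPlane 0 → ℂ} {a b : ℕ+ → ℂ}
    (hf : HasWienerSeries f a) (hg : HasWienerSeries g b) : HasWienerSeries (f + g) (a + b) := by
  refine ⟨(hf.1.add hg.1).of_nonneg_of_le (fun _ => norm_nonneg _) fun n => norm_add_le _ _,
    fun s => ?_⟩
  have h := (hf.2 s).add (hg.2 s)
  convert! h using 1
  ext n
  simp [dirichletTerm, add_mul]

theorem HasWienerSeries.smul {f : rightHalfPlane 0 → ℂ} {a : ℕ+ → ℂ} (c : ℂ)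
    (hf : HasWienerSeries f a) : HasWienerSeries (c • f) (c • a) := by
  refine ⟨by simpa [norm_mul] using hf.1.mul_left ‖c‖, fun s => ?_⟩
  have h := (hf.2 s).mul_left c
  convert! h using 1
  ext n
  simp [dirichletTerm, mul_assoc]

theorem HasWienerSeries.zero : HasWienerSeries 0 0 :=
  ⟨by simp, fun s => by
    convert! (hasSum_zero : HasSum (fun _ : ℕ+ => (0 : ℂ)) 0) using 1
    ext n
    simp [dirichletTerm]⟩

/-- The coefficients of an absolutely convergent Dirichlet series are determined by its sum. -/
theorem HasWienerSeries.unique {f : rightHalfPlane 0 → ℂ} {a b : ℕ+ → ℂ}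
    (ha : HasWienerSeries f a) (hb : HasWienerSeries f b) : a = b := by
  have key : ∀ c : ℕ+ → ℂ, HasWienerSeries f c → ∃ C : ℕ → ℂ, (∀ n : ℕ+, C n = c n) ∧
      ∀ s : rightHalfPlane 0, LSeriesHasSum C s (f s) := by
    intro c hc
    refine ⟨fun n => if n = 0 then 0 else c n.toPNat', fun n => by simp, fun s => ?_⟩
    have h := hc.2 s
    refine (PNat.coe_injective.hasSum_iff (fun n hn => ?_)).1 ?_
    · have : n = 0 := by
        by_contra h0
        exact hn ⟨⟨n, Nat.pos_of_ne_zero h0⟩, rfl⟩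
      simp [this]
    · convert! h using 1
      ext n
      rw [Function.comp_apply, LSeries.term_def, if_neg n.ne_zero, if_neg n.ne_zero,
        PNat.coe_toPNat', dirichletTerm, Complex.cpow_neg, div_eq_mul_inv]
  obtain ⟨A, hA, hA'⟩ := key a ha
  obtain ⟨B, hB, hB'⟩ := key b hb
  have h1 : (1 : ℂ) ∈ rightHalfPlane 0 := by simp [rightHalfPlane]
  have lt : ∀ C : ℕ → ℂ, LSeriesHasSum C 1 (f ⟨1, h1⟩) → LSeries.abscissaOfAbsConv C < ⊤ :=
    fun C hC => hC.LSeriesSummable.abscissaOfAbsConv_le.trans_lt (EReal.coe_lt_top _)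
  ext n
  rw [← hA n, ← hB n]
  refine LSeries.eq_of_LSeries_eventually_eq (lt A (hA' ⟨1, h1⟩)) (lt B (hB' ⟨1, h1⟩)) ?_ n.ne_zero
  filter_upwards [Filter.eventually_gt_atTop 0] with x hx
  have hx' : (x : ℂ) ∈ rightHalfPlane 0 := by simpa [rightHalfPlane] using hx
  rw [(hA' ⟨x, hx'⟩).LSeries_eq, (hB' ⟨x, hx'⟩).LSeries_eq]

/-- The Wiener algebra of Dirichlet series as a vector space of functions on `{Re s > 0}`: the
sums of Dirichlet series `∑ a_n n^{-s}` with `∑ |a_n| < ∞`. -/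
def wienerSubmodule : Submodule ℂ (rightHalfPlane 0 → ℂ) where
  carrier := {f | ∃ a : ℕ+ → ℂ, HasWienerSeries f a}
  add_mem' := by
    rintro f g ⟨a, ha⟩ ⟨b, hb⟩
    exact ⟨_, ha.add hb⟩
  zero_mem' := ⟨0, HasWienerSeries.zero⟩
  smul_mem' := by
    rintro c f ⟨a, ha⟩
    exact ⟨_, ha.smul c⟩

/-- The Wiener algebra `𝒜⁺`, as a type of its own, so that it carries the norm `∑ |a_n|` below
and not the topology of pointwise convergence. -/
def WienerAlgebra : Type := wienerSubmodule

namespace WienerAlgebra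

noncomputable instance : AddCommGroup WienerAlgebra :=
  inferInstanceAs (AddCommGroup wienerSubmodule)

noncomputable instance : Module ℂ WienerAlgebra := inferInstanceAs (Module ℂ wienerSubmodule)

instance : CoeFun WienerAlgebra (fun _ => rightHalfPlane 0 → ℂ) := ⟨fun f => f.1⟩

/-- The coefficients `a_n` of `f ∈ 𝒜⁺`. -/
noncomputable def coeff (f : WienerAlgebra) : ℕ+ → ℂ := f.2.choose

theorem hasWienerSeries_coeff (f : WienerAlgebra) : HasWienerSeries f f.coeff := f.2.choose_spec

theorem coeff_add (f g : WienerAlgebra) : (f + g).coeff = f.coeff + g.coeff :=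
  (f + g).hasWienerSeries_coeff.unique (f.hasWienerSeries_coeff.add g.hasWienerSeries_coeff)

theorem coeff_smul (c : ℂ) (f : WienerAlgebra) : (c • f).coeff = c • f.coeff :=
  (c • f).hasWienerSeries_coeff.unique (f.hasWienerSeries_coeff.smul c)

/-- `‖f‖ = ∑ |a_n|`. -/
noncomputable instance : Norm WienerAlgebra := ⟨fun f => ∑' n, ‖f.coeff n‖⟩

theorem norm_def (f : WienerAlgebra) : ‖f‖ = ∑' n, ‖f.coeff n‖ := rfl

theorem core : NormedSpace.Core ℂ WienerAlgebra where
  norm_nonneg f := tsum_nonneg fun _ => norm_nonneg _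
  norm_smul c f := by simp [norm_def, coeff_smul, tsum_mul_left]
  norm_triangle f g := by
    have hf := f.hasWienerSeries_coeff.1
    have hg := g.hasWienerSeries_coeff.1
    rw [norm_def, norm_def, norm_def, ← hf.tsum_add hg]
    exact (f + g).hasWienerSeries_coeff.1.tsum_le_tsum
      (fun n => by rw [coeff_add]; exact norm_add_le _ _) (hf.add hg)
  norm_eq_zero_iff f := by
    constructor
    · intro h
      have h0 := (hasSum_zero_iff_of_nonneg fun n => norm_nonneg (f.coeff n)).1
        ((norm_def f).symm.trans h ▸ f.hasWienerSeries_coeff.1.hasSum)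
      have h1 : f.coeff = 0 := funext fun n => norm_eq_zero.1 (congrFun h0 n)
      refine Subtype.ext (funext fun s => ?_)
      have h2 := f.hasWienerSeries_coeff.2 s
      rw [h1] at h2
      exact h2.unique (HasWienerSeries.zero.2 s)
    · rintro rfl
      have h1 : (0 : WienerAlgebra).coeff = 0 :=
        (0 : WienerAlgebra).hasWienerSeries_coeff.unique HasWienerSeries.zero
      simp [norm_def, h1]

noncomputable instance : NormedAddCommGroup WienerAlgebra := NormedAddCommGroup.ofCore core

noncomputable instance : NormedSpace ℂ WienerAlgebra := NormedSpace.ofCore core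

end WienerAlgebra

/-- The bounded operator `C` on `𝒜⁺` is the composition operator `f ↦ f ∘ φ`. -/
def IsCompositionOperator (φ : ℂ → ℂ) (hφ : Set.MapsTo φ (rightHalfPlane 0) (rightHalfPlane 0))
    (C : WienerAlgebra →L[ℂ] WienerAlgebra) : Prop :=
  ∀ (f : WienerAlgebra) (s : rightHalfPlane 0), C f s = f (hφ.restrict φ _ _ s)

end Wiener

/-- `r`-summing operators (`1 ≤ r < ∞`). -/
def IsSumming {X Y : Type*} [NormedAddCommGroup X] [NormedSpace ℂ X] [NormedAddCommGroup Y]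
    [NormedSpace ℂ Y] (r : ℝ) (u : X →L[ℂ] Y) : Prop :=
  ∃ K : ℝ, 0 < K ∧ ∀ (n : ℕ) (x : Fin n → X),
    (∑ k, ‖u (x k)‖ ^ r) ^ (1 / r) ≤
      K * ⨆ ξ : Metric.closedBall (0 : StrongDual ℂ X) 1, (∑ k, ‖ξ.1 (x k)‖ ^ r) ^ (1 / r)

/-- Absolutely summing operators are the `1`-summing ones. -/
def IsAbsolutelySumming {X Y : Type*} [NormedAddCommGroup X] [NormedSpace ℂ X]
    [NormedAddCommGroup Y] [NormedSpace ℂ Y] (u : X →L[ℂ] Y) : Prop := IsSumming 1 u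

section Hardy

/-- The infinite torus `𝕋^∞`, with one coordinate for each prime; the circle is `ℝ / ℤ`, the
point `θ` standing for `exp (2πiθ)`. -/
abbrev InfTorus : Type := Nat.Primes → UnitAddCircle

/-- The normalized Haar measure of `𝕋^∞`. -/
noncomputable def InfTorus.haar : MeasureTheory.Measure InfTorus :=
  MeasureTheory.Measure.infinitePi fun _ => AddCircle.haarAddCircle

/-- The character `z ↦ z^α = ∏ z_p^{α_p}` of `𝕋^∞`. -/
noncomputable def InfTorus.character (α : Nat.Primes →₀ ℤ) (z : InfTorus) : ℂ :=
  α.prod fun p k => fourier k (z p)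

/-- The Fourier coefficient of `F` at `α`. -/
noncomputable def InfTorus.fourierCoeff (F : InfTorus → ℂ) (α : Nat.Primes →₀ ℤ) : ℂ :=
  ∫ z, F z * InfTorus.character (-α) z ∂InfTorus.haar

/-- The Hardy space `H^p(𝕋^∞)`, `1 ≤ p`: the functions of `L^p` whose Fourier coefficients vanish
at every `α` that has a negative entry. -/
def InfTorus.MemHardy (F : InfTorus → ℂ) (p : ENNReal) : Prop :=
  MeasureTheory.MemLp F p InfTorus.haar ∧
    ∀ α : Nat.Primes →₀ ℤ, (∃ q, α q < 0) → InfTorus.fourierCoeff F α = 0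

/-- The integer `n = ∏ p^{α_p}`. -/
noncomputable def bohrIndex (α : Nat.Primes →₀ ℕ) : ℕ+ := α.prod fun p k => (p : ℕ+) ^ k

/-- The Hardy space `ℋ^p` of Dirichlet series, `1 ≤ p`: the convergent Dirichlet series `∑ a_n n^{-s}`
whose Bohr lift `∑ a_n z^α`, `n = ∏ p^{α_p}`, is the Fourier series of a function
of `H^p(𝕋^∞)`. -/
def MemDirichletHardy (f : ℂ → ℂ) (p : ENNReal) : Prop :=
  ∃ a : ℕ+ → ℂ, HasDirichletSeries f a ∧ ∃ F : InfTorus → ℂ, InfTorus.MemHardy F p ∧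
    ∀ α : Nat.Primes →₀ ℕ,
      InfTorus.fourierCoeff F (α.mapRange Nat.cast Nat.cast_zero) = a (bohrIndex α)

end Hardy

/-- `f` maps the open set `U` conformally (holomorphically and bijectively) onto `V`. -/
def IsConformalMapOnto (f : ℂ → ℂ) (U V : Set ℂ) : Prop :=
  DifferentiableOn ℂ f U ∧ Set.BijOn f U V

/-- The half-strip `{z : Re z > 1, |Im z| < π}`. -/
def halfStrip : Set ℂ := {z | 1 < z.re ∧ |z.im| < Real.pi}

/-!
With `h = (1 + z) / (1 - z)`, the map `w = √(1 + h²) - h` sends the unit disk conformally onto the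
half disk `{|w| < 1, Re w > 0}`, and `f = 1 - 2 log w` sends it onto the half-strip. The series is
`φ(s) = f(2^{-s})`; it is unbounded, hence outside the Wiener algebra.

For the composition operator, expand `n^{-φ(s)} = ∑ₖ c_{n,k} 2^{-ks}`, where `c_{n,k}` are the
Taylor coefficients of `g = exp (-L f)`, `L = log n`. If `∑ₖ sup_n |c_{n,k}| < ∞`, then the operator
is `∑ₖ ξₖ ⊗ 2^{-ks}` with functionals `ξₖ` of summable norms: it is nuclear, hence bounded, compact
and absolutely summing (`exists_compositionOperator`). The summability
(`exists_summable_bound_taylorCoeff`) comes from the shape of the half-strip. Here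
`|g| = n^{-1} |w|^{2L}`, and for `n ≥ 2` the factor `|w|^{2L} ≤ |w|` absorbs the pole of
`f' = 4 / ((1 - z) √(2 (1 + z²)))` at `z = 1`, the preimage of infinity. What is left in `g'` is the
inverse square root singularity at each of the preimages `±i` of the two corners:
`|g'|² ≤ 8 (log n / n)² / |1 + z²|` (`norm_deriv_expStrip_sq_le`). Parseval's identity on the circle
of radius `r` then bounds `∑ₖ k² |c_{n,k}|² r^{2k}` by a multiple of
`(log n / n)² (1 - r²)^{-1/2}`. This is summable over `n`, and a dyadic decomposition in `k` gives
the summability of `(∑ₙ |c_{n,k}|²)^{1/2}`, which bounds `sup_n |c_{n,k}|`.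

For the Hardy spaces, `f` has radial limits at the points of the unit circle other than `1` and
`±i`, with a logarithmic bound `C + 2 log (8 / |1 - z|)` that is uniform along radii and lies in
every `L^p`, `p < ∞`. By dominated convergence the Fourier coefficients of the boundary values are the Taylor
coefficients (`fourierCoeff_stripMap_circle`), and the Bohr lift of `φ` is this boundary function
of the single variable `z_2` on the infinite torus.
-/

open Filter Topology MeasureTheory

/-! ### The conformal map onto the half-strip -/

/-- The branch of `√(2(1 + z²))` with positive real part, on the closed unit disk without `±i`. -/
noncomputable def diskSqrt (z : ℂ) : ℂ := (2 * (1 + z ^ 2)) ^ (2⁻¹ : ℂ)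

/-- The conformal map `z ↦ √(1 + h²) - h`, `h = (1 + z) / (1 - z)`, of the unit disk onto the half
disk `{w : |w| < 1, Re w > 0}`. It is written here in a form that makes sense on the unit circle
too, where it vanishes at `1` only. -/
noncomputable def halfDiskMap (z : ℂ) : ℂ := (1 - z) / (diskSqrt z + (1 + z))

/-- The conformal map `1 - 2 log w` of the unit disk onto the half-strip, `w` being `halfDiskMap`;
that is, `1 + 2 arsinh ((1 + z) / (1 - z))`. -/
noncomputable def stripMap (z : ℂ) : ℂ := 1 - 2 * Complex.log (halfDiskMap z)

theorem diskSqrt_sq (z : ℂ) : diskSqrt z ^ 2 = 2 * (1 + z ^ 2) := by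
  have := Complex.cpow_nat_inv_pow (2 * (1 + z ^ 2)) (n := 2) two_ne_zero
  simpa only [diskSqrt, Nat.cast_ofNat] using this

theorem re_one_add_sq_pos {z : ℂ} (hz : ‖z‖ ≤ 1) (h : 1 + z ^ 2 ≠ 0) : 0 < (1 + z ^ 2).re := by
  have h1 : z.re ^ 2 + z.im ^ 2 ≤ 1 := by
    have := Complex.sq_norm z
    rw [Complex.normSq_apply] at this
    nlinarith [norm_nonneg z]
  have h2 : (1 + z ^ 2).re = 1 + z.re ^ 2 - z.im ^ 2 := by simp [pow_two]; ring
  have h3 : (1 + z ^ 2).im = 2 * z.re * z.im := by simp [pow_two]; ring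
  rw [h2]
  by_contra! h4
  have hx : z.re = 0 := by nlinarith [sq_nonneg z.re]
  refine h (Complex.ext ?_ ?_)
  · rw [h2, hx] at *
    simp only [Complex.zero_re]
    nlinarith
  · simp [h3, hx]

theorem one_add_sq_ne_zero {z : ℂ} (hz : ‖z‖ < 1) : 1 + z ^ 2 ≠ 0 := by
  intro h
  have : z ^ 2 = -1 := by linear_combination h
  have h1 : ‖z‖ ^ 2 = 1 := by rw [← norm_pow, this]; simp
  nlinarith [norm_nonneg z]

theorem one_sub_ne_zero_of_norm_lt {z : ℂ} (hz : ‖z‖ < 1) : 1 - z ≠ 0 := by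
  intro h
  have : z = 1 := by linear_combination -h
  simp [this] at hz

theorem two_mul_one_add_sq_mem_slitPlane {z : ℂ} (hz : ‖z‖ ≤ 1) (h : 1 + z ^ 2 ≠ 0) :
    2 * (1 + z ^ 2) ∈ Complex.slitPlane := by
  left
  have := re_one_add_sq_pos hz h
  rw [Complex.mul_re]
  simpa using this

theorem diskSqrt_re_pos {z : ℂ} (hz : ‖z‖ ≤ 1) (h : 1 + z ^ 2 ≠ 0) : 0 < (diskSqrt z).re := by
  have h1 : 0 < (2 * (1 + z ^ 2)).re := by
    have := re_one_add_sq_pos hz h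
    rw [Complex.mul_re]
    simpa using this
  rw [diskSqrt, Complex.cpow_inv_two_re]
  have := norm_nonneg (2 * (1 + z ^ 2))
  positivity

theorem diskSqrt_ne_zero {z : ℂ} (hz : ‖z‖ ≤ 1) (h : 1 + z ^ 2 ≠ 0) : diskSqrt z ≠ 0 := by
  intro h0
  have := diskSqrt_re_pos hz h
  simp [h0] at this

theorem neg_one_le_re {z : ℂ} (hz : ‖z‖ ≤ 1) : -1 ≤ z.re := by
  have := Complex.abs_re_le_norm z
  linarith [neg_abs_le z.re]

theorem denom_ne_zero {z : ℂ} (hz : ‖z‖ ≤ 1) (h : 1 + z ^ 2 ≠ 0) :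
    diskSqrt z + (1 + z) ≠ 0 := by
  intro h0
  have h1 := diskSqrt_re_pos hz h
  have h2 := congrArg Complex.re h0
  have := neg_one_le_re hz
  simp only [Complex.add_re, Complex.one_re, Complex.zero_re] at h2
  linarith

theorem differentiableAt_diskSqrt {z : ℂ} (hz : ‖z‖ ≤ 1) (h : 1 + z ^ 2 ≠ 0) :
    DifferentiableAt ℂ diskSqrt z := by
  unfold diskSqrt
  refine DifferentiableAt.cpow_const (by fun_prop) (two_mul_one_add_sq_mem_slitPlane hz h)

theorem differentiableAt_halfDiskMap {z : ℂ} (hz : ‖z‖ ≤ 1) (h : 1 + z ^ 2 ≠ 0) :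
    DifferentiableAt ℂ halfDiskMap z := by
  have h1 := differentiableAt_diskSqrt hz h
  have h2 := denom_ne_zero hz h
  unfold halfDiskMap
  fun_prop (disch := assumption)

theorem halfDiskMap_ne_zero {z : ℂ} (hz : ‖z‖ ≤ 1) (h : 1 + z ^ 2 ≠ 0) (h1 : z ≠ 1) :
    halfDiskMap z ≠ 0 :=
  div_ne_zero (sub_ne_zero.2 h1.symm) (denom_ne_zero hz h)

theorem inv_halfDiskMap_sub {z : ℂ} (hz : ‖z‖ < 1) :
    (halfDiskMap z)⁻¹ - halfDiskMap z = 2 * ((1 + z) / (1 - z)) := by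
  have h1 := denom_ne_zero hz.le (one_add_sq_ne_zero hz)
  have h2 := one_sub_ne_zero_of_norm_lt hz
  have h3 := diskSqrt_sq z
  rw [halfDiskMap]
  field_simp
  linear_combination h3

theorem inv_halfDiskMap_add {z : ℂ} (hz : ‖z‖ < 1) :
    (halfDiskMap z)⁻¹ + halfDiskMap z = 2 * (diskSqrt z / (1 - z)) := by
  have h1 := denom_ne_zero hz.le (one_add_sq_ne_zero hz)
  have h2 := one_sub_ne_zero_of_norm_lt hz
  have h3 := diskSqrt_sq z
  rw [halfDiskMap]
  field_simp
  linear_combination -h3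

theorem re_cayley_pos {z : ℂ} (hz : ‖z‖ < 1) : 0 < ((1 + z) / (1 - z)).re := by
  have h2 := one_sub_ne_zero_of_norm_lt hz
  have h3 := Complex.normSq_pos.2 h2
  have h4 := Complex.sq_norm z
  rw [Complex.normSq_apply] at h4
  rw [Complex.div_re, ← add_div]
  refine div_pos ?_ h3
  simp
  nlinarith [norm_nonneg z]

/-- The square `1 + h²` of `√(1 + h²)` is never in `(-∞, 0]` when `Re h > 0`, so the real part of
the root has constant sign, by connectedness. -/
theorem re_diskSqrt_div_pos {z : ℂ} (hz : ‖z‖ < 1) : 0 < (diskSqrt z / (1 - z)).re := by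
  by_contra! hneg
  have hc : ContinuousOn (fun z : ℂ => (diskSqrt z / (1 - z)).re) (Metric.ball 0 1) := by
    intro y hy
    have hy' : ‖y‖ < 1 := by simpa using hy
    have h1 := (differentiableAt_diskSqrt hy'.le (one_add_sq_ne_zero hy')).continuousAt
    have h2 := one_sub_ne_zero_of_norm_lt hy'
    exact (Complex.continuous_re.continuousAt.comp
      (h1.div (by fun_prop) h2)).continuousWithinAt
  have hpre : IsPreconnected (Metric.ball (0 : ℂ) 1) := (convex_ball 0 1).isPreconnected
  have h0 : (0 : ℂ) ∈ Metric.ball (0 : ℂ) 1 := by simp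
  have h0' : 0 ≤ (diskSqrt 0 / (1 - 0)).re := by
    have := diskSqrt_re_pos (z := 0) (by simp) (by simp)
    simpa using this.le
  obtain ⟨y, hy, hy0⟩ := hpre.intermediate_value (show z ∈ Metric.ball (0 : ℂ) 1 by simpa using hz)
    h0 hc ⟨hneg, h0'⟩
  have hy' : ‖y‖ < 1 := by simpa using hy
  have h2 := one_sub_ne_zero_of_norm_lt hy'
  set q := diskSqrt y / (1 - y) with hq
  set h := (1 + y) / (1 - y) with hh
  have hpos : 0 < h.re := re_cayley_pos hy'
  have e : q ^ 2 = 1 + h ^ 2 := by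
    rw [hq, hh, div_pow, div_pow, diskSqrt_sq]
    field_simp
    ring
  have hy0 : q.re = 0 := hy0
  have e1 := congrArg Complex.re e
  have e2 := congrArg Complex.im e
  simp [pow_two, hy0] at e1 e2
  have him : h.im = 0 := by
    have : h.re * h.im = 0 := by linarith
    exact (mul_eq_zero.1 this).resolve_left hpos.ne'
  rw [him] at e1
  nlinarith [mul_self_nonneg q.im]

theorem halfDiskMap_re_pos {z : ℂ} (hz : ‖z‖ < 1) : 0 < (halfDiskMap z).re := by
  have h1 := congrArg Complex.re (inv_halfDiskMap_add hz)
  have h2 := re_diskSqrt_div_pos hz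
  set w := halfDiskMap z with hw
  have e : (2 * (diskSqrt z / (1 - z))).re = 2 * (diskSqrt z / (1 - z)).re := by
    rw [Complex.mul_re]; simp
  rw [e, Complex.add_re, Complex.inv_re] at h1
  have h3 : 0 < w.re * ((Complex.normSq w)⁻¹ + 1) := by
    rw [mul_add, ← div_eq_mul_inv]
    linarith
  have h4 : 0 < (Complex.normSq w)⁻¹ + 1 := by
    have := Complex.normSq_nonneg w
    positivity
  exact (pos_iff_pos_of_mul_pos h3).2 h4

theorem norm_halfDiskMap_lt_one {z : ℂ} (hz : ‖z‖ < 1) : ‖halfDiskMap z‖ < 1 := by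
  have h0 := halfDiskMap_re_pos hz
  have h1 := congrArg Complex.re (inv_halfDiskMap_sub hz)
  have h2 := re_cayley_pos hz
  set w := halfDiskMap z with hw
  have e : (2 * ((1 + z) / (1 - z))).re = 2 * ((1 + z) / (1 - z)).re := by
    rw [Complex.mul_re]; simp
  rw [e, Complex.sub_re, Complex.inv_re] at h1
  have h3 : 0 < w.re * ((Complex.normSq w)⁻¹ - 1) := by
    rw [mul_sub, ← div_eq_mul_inv]
    linarith
  have h4 : 1 < (Complex.normSq w)⁻¹ := by linarith [(pos_iff_pos_of_mul_pos h3).1 h0]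
  have h5 : Complex.normSq w < 1 := (one_lt_inv_iff₀.1 h4).2
  rw [← Complex.sq_norm] at h5
  nlinarith [norm_nonneg w]

theorem halfDiskMap_mem_slitPlane {z : ℂ} (hz : ‖z‖ < 1) : halfDiskMap z ∈ Complex.slitPlane :=
  Or.inl (halfDiskMap_re_pos hz)

theorem differentiableOn_stripMap : DifferentiableOn ℂ stripMap (Metric.ball 0 1) := by
  intro z hz
  have hz' : ‖z‖ < 1 := by simpa using hz
  have h1 := differentiableAt_halfDiskMap hz'.le (one_add_sq_ne_zero hz')
  have h2 := halfDiskMap_mem_slitPlane hz'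
  exact (((h1.clog h2).const_mul 2).const_sub 1).differentiableWithinAt

theorem stripMap_re {z : ℂ} : (stripMap z).re = 1 - 2 * Real.log ‖halfDiskMap z‖ := by
  rw [stripMap, Complex.sub_re, Complex.mul_re, Complex.log_re]
  simp

theorem mapsTo_stripMap : Set.MapsTo stripMap (Metric.ball 0 1) halfStrip := by
  intro z hz
  have hz' : ‖z‖ < 1 := by simpa using hz
  have h0 : halfDiskMap z ≠ 0 := Complex.slitPlane_ne_zero (halfDiskMap_mem_slitPlane hz')
  constructor
  · rw [stripMap_re]
    have := Real.log_neg (norm_pos_iff.2 h0) (norm_halfDiskMap_lt_one hz')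
    linarith
  · have h1 := Complex.abs_arg_lt_pi_div_two_iff.2 (Or.inl (halfDiskMap_re_pos hz'))
    have h2 : (stripMap z).im = -(2 * (halfDiskMap z).arg) := by
      rw [stripMap, Complex.sub_im, Complex.mul_im, Complex.log_im]
      simp
    rw [h2, abs_neg, abs_mul, abs_two]
    linarith

theorem injOn_stripMap : Set.InjOn stripMap (Metric.ball 0 1) := by
  intro x hx y hy hxy
  have hx' : ‖x‖ < 1 := by simpa using hx
  have hy' : ‖y‖ < 1 := by simpa using hy
  have h1 : Complex.log (halfDiskMap x) = Complex.log (halfDiskMap y) := by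
    simp only [stripMap] at hxy
    linear_combination (-1 / 2 : ℂ) * hxy
  have h2 : halfDiskMap x = halfDiskMap y := by
    rw [← Complex.exp_log (Complex.slitPlane_ne_zero (halfDiskMap_mem_slitPlane hx')), h1,
      Complex.exp_log (Complex.slitPlane_ne_zero (halfDiskMap_mem_slitPlane hy'))]
  have h3 := inv_halfDiskMap_sub hx'
  rw [h2, inv_halfDiskMap_sub hy'] at h3
  have h4 := one_sub_ne_zero_of_norm_lt hx'
  have h5 := one_sub_ne_zero_of_norm_lt hy'
  field_simp at h3
  linear_combination (-1 / 2 : ℂ) * h3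

/-- A square root with positive real part is the principal one. -/
theorem eq_of_sq_eq_of_re_pos {a b : ℂ} (h : a ^ 2 = b ^ 2) (ha : 0 < a.re) (hb : 0 < b.re) :
    a = b := by
  rcases sq_eq_sq_iff_eq_or_eq_neg.1 h with h | h
  · exact h
  · rw [h, Complex.neg_re] at ha
    linarith

theorem surjOn_stripMap : Set.SurjOn stripMap (Metric.ball 0 1) halfStrip := by
  rintro ζ ⟨hre, him⟩
  -- `w` is the point of the half disk that the logarithm sends to `ζ`, and `h` solves
  -- `1 / w - w = 2 h`
  set η : ℂ := -((ζ - 1) / 2) with hη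
  have hη1 : η.re = -((ζ.re - 1) / 2) := by
    simp [hη]
  have hη2 : η.im = -(ζ.im / 2) := by
    simp [hη]
  rw [abs_lt] at him
  set w : ℂ := Complex.exp η with hw
  have hw0 : w ≠ 0 := Complex.exp_ne_zero _
  have hwre : 0 < w.re := by
    rw [hw, Complex.exp_re]
    refine mul_pos (Real.exp_pos _) (Real.cos_pos_of_mem_Ioo ⟨?_, ?_⟩) <;> rw [hη2] <;> linarith
  have hw1 : ‖w‖ < 1 := by
    rw [hw, Complex.norm_exp, Real.exp_lt_one_iff, hη1]
    linarith
  have hlog : Complex.log w = η := by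
    rw [hw, Complex.log_exp] <;> rw [hη2] <;> linarith [Real.pi_pos]
  have hn0 := Complex.normSq_pos.2 hw0
  have hn1 : Complex.normSq w < 1 := by
    rw [← Complex.sq_norm]
    nlinarith [norm_nonneg w]
  set h : ℂ := (w⁻¹ - w) / 2 with hh
  have hhre : 0 < h.re := by
    have e : h.re = (w.re * ((Complex.normSq w)⁻¹ - 1)) / 2 := by
      simp [hh, Complex.normSq]; ring
    have := (one_lt_inv₀ hn0).2 hn1
    rw [e]
    have : 0 < (Complex.normSq w)⁻¹ - 1 := by linarith
    positivity
  have hh1 : h + 1 ≠ 0 := by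
    intro h0
    have := congrArg Complex.re h0
    simp at this
    linarith
  set z : ℂ := (h - 1) / (h + 1) with hz
  have hz1 : ‖z‖ < 1 := by
    rw [hz, norm_div, div_lt_one (norm_pos_iff.2 hh1)]
    refine (sq_lt_sq₀ (norm_nonneg _) (norm_nonneg _)).1 ?_
    rw [Complex.sq_norm, Complex.sq_norm, Complex.normSq_apply, Complex.normSq_apply]
    simp
    nlinarith
  have hzh : (1 + z) / (1 - z) = h := by
    have : 1 - z ≠ 0 := one_sub_ne_zero_of_norm_lt hz1
    rw [div_eq_iff this, hz]
    field_simp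
    ring
  have hwz : halfDiskMap z = w := by
    have h1z := one_sub_ne_zero_of_norm_lt hz1
    have hs : diskSqrt z / (1 - z) = (w⁻¹ + w) / 2 := by
      refine eq_of_sq_eq_of_re_pos ?_ (re_diskSqrt_div_pos hz1) ?_
      · have e : (diskSqrt z / (1 - z)) ^ 2 = 1 + ((1 + z) / (1 - z)) ^ 2 := by
          rw [div_pow, div_pow, diskSqrt_sq]
          field_simp
          ring
        rw [e, hzh, hh]
        field_simp
        ring
      · have e : ((w⁻¹ + w) / 2).re = (w.re * ((Complex.normSq w)⁻¹ + 1)) / 2 := by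
          simp [Complex.normSq]; ring
        rw [e]
        positivity
    have e1 := inv_halfDiskMap_add hz1
    have e2 := inv_halfDiskMap_sub hz1
    rw [hs] at e1
    rw [hzh, hh] at e2
    linear_combination (1 / 2 : ℂ) * e1 - (1 / 2 : ℂ) * e2
  refine ⟨z, by simpa using hz1, ?_⟩
  rw [stripMap, hwz, hlog, hη]
  ring

theorem isConformalMapOnto_stripMap :
    IsConformalMapOnto stripMap (Metric.ball 0 1) halfStrip :=
  ⟨differentiableOn_stripMap, mapsTo_stripMap, injOn_stripMap, surjOn_stripMap⟩

/-- Differentiating `1 / w - w = 2 h` and inserting `1 / w + w = 2 √(1 + h²)` gives `w' / w`. -/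
theorem hasDerivAt_stripMap {z : ℂ} (hz : ‖z‖ < 1) :
    HasDerivAt stripMap (4 / ((1 - z) * diskSqrt z)) z := by
  have hw := (differentiableAt_halfDiskMap hz.le (one_add_sq_ne_zero hz)).hasDerivAt
  have hs := halfDiskMap_mem_slitPlane hz
  have hw0 := Complex.slitPlane_ne_zero hs
  have h1z := one_sub_ne_zero_of_norm_lt hz
  have hR := diskSqrt_ne_zero hz.le (one_add_sq_ne_zero hz)
  have h1 := (hw.inv hw0).sub hw
  have h2 : HasDerivAt (fun z : ℂ => 2 * ((1 + z) / (1 - z)))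
      (2 * ((1 * (1 - z) - (1 + z) * (-1)) / (1 - z) ^ 2)) z :=
    ((((hasDerivAt_id z).const_add 1).div ((hasDerivAt_id z).const_sub 1) h1z).const_mul 2)
  have h3 : (halfDiskMap⁻¹ - halfDiskMap) =ᶠ[𝓝 z] fun z : ℂ => 2 * ((1 + z) / (1 - z)) := by
    filter_upwards [Metric.isOpen_ball.mem_nhds (show z ∈ Metric.ball (0 : ℂ) 1 by simpa using hz)]
      with y hy
    exact inv_halfDiskMap_sub (by simpa using hy)
  have h4 := h1.unique (h2.congr_of_eventuallyEq h3)
  have h5 := inv_halfDiskMap_add hz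
  convert! ((hw.clog hs).const_mul 2).const_sub 1 using 1
  set w := halfDiskMap z
  set d := deriv halfDiskMap z
  have h6 : -(d / w) * (w⁻¹ + w) = 4 / (1 - z) ^ 2 := by
    have : -(d / w) * (w⁻¹ + w) = -d / w ^ 2 - d := by field_simp; ring
    rw [this, h4]
    ring
  rw [h5] at h6
  have h7 : -(d / w) = 4 / (1 - z) ^ 2 * ((1 - z) / (2 * diskSqrt z)) := by
    rw [← h6]
    field_simp
  rw [← mul_neg, h7]
  field_simp

theorem one_le_norm_denom {z : ℂ} (hz : ‖z‖ < 1) : 1 ≤ ‖diskSqrt z + (1 + z)‖ := by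
  have h1 := norm_halfDiskMap_lt_one hz
  have h0 := norm_pos_iff.2 (denom_ne_zero hz.le (one_add_sq_ne_zero hz))
  rw [halfDiskMap, norm_div, div_lt_one h0] at h1
  have h2 := Complex.re_le_norm (1 - z)
  have h3 := Complex.re_le_norm (diskSqrt z + (1 + z))
  have h4 := diskSqrt_re_pos hz.le (one_add_sq_ne_zero hz)
  simp at h2 h3
  linarith

theorem norm_halfDiskMap_le {z : ℂ} (hz : ‖z‖ < 1) : ‖halfDiskMap z‖ ≤ ‖1 - z‖ := by
  rw [halfDiskMap, norm_div]
  exact div_le_self (norm_nonneg _) (one_le_norm_denom hz)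

theorem le_norm_halfDiskMap {z : ℂ} (hz : ‖z‖ < 1) : ‖1 - z‖ / 4 ≤ ‖halfDiskMap z‖ := by
  rw [halfDiskMap, norm_div]
  have h0 := norm_pos_iff.2 (denom_ne_zero hz.le (one_add_sq_ne_zero hz))
  refine div_le_div_of_nonneg_left (norm_nonneg _) h0 ?_
  have h1 : ‖diskSqrt z‖ ^ 2 ≤ 4 := by
    rw [← norm_pow, diskSqrt_sq, norm_mul]
    have : ‖1 + z ^ 2‖ ≤ 2 := by
      refine (norm_add_le _ _).trans ?_
      rw [norm_pow, norm_one]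
      nlinarith [norm_nonneg z]
    rw [Complex.norm_ofNat]
    linarith
  have h2 : ‖diskSqrt z‖ ≤ 2 := by nlinarith [norm_nonneg (diskSqrt z)]
  have h3 : ‖1 + z‖ ≤ 2 := by
    refine (norm_add_le _ _).trans ?_
    rw [norm_one]
    linarith
  exact (norm_add_le _ _).trans (by linarith)

/-! ### Power series on the unit disk and Parseval's identity -/

/-- The `k`-th Taylor coefficient of `g` at `0`. -/
noncomputable def taylorCoeff (g : ℂ → ℂ) (k : ℕ) : ℂ := (k.factorial : ℂ)⁻¹ * iteratedDeriv k g 0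

theorem hasSum_taylorCoeff {g : ℂ → ℂ} (hg : DifferentiableOn ℂ g (Metric.ball 0 1)) {z : ℂ}
    (hz : ‖z‖ < 1) : HasSum (fun k => taylorCoeff g k * z ^ k) (g z) := by
  have h := Complex.hasSum_taylorSeries_on_ball hg (z := z) (by simpa using hz)
  refine h.congr_fun fun k => ?_
  simp only [taylorCoeff, sub_zero, smul_eq_mul]
  ring

theorem taylorCoeff_deriv (g : ℂ → ℂ) (k : ℕ) :
    taylorCoeff (deriv g) k = (k + 1) * taylorCoeff g (k + 1) := by
  have : ((k : ℂ) + 1) ≠ 0 := by exact_mod_cast k.succ_ne_zero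
  rw [taylorCoeff, taylorCoeff, iteratedDeriv_succ', Nat.factorial_succ]
  push_cast
  field_simp

theorem taylorCoeff_zero (g : ℂ → ℂ) : taylorCoeff g 0 = g 0 := by simp [taylorCoeff]

theorem norm_fourier_one (θ : UnitAddCircle) : ‖fourier 1 θ‖ = 1 := by
  rw [fourier_one]; exact Circle.norm_coe _

theorem fourier_nat_eq_pow (k : ℕ) (θ : UnitAddCircle) :
    fourier (k : ℤ) θ = (fourier 1 θ : ℂ) ^ k := by
  induction k with
  | zero => simp
  | succ k ih => rw [Nat.cast_succ, fourier_add, ih, pow_succ]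

theorem norm_mul_fourier_one_lt {r : ℝ} (h0 : 0 ≤ r) (h1 : r < 1) (θ : UnitAddCircle) :
    ‖(r : ℂ) * fourier 1 θ‖ < 1 := by
  rw [norm_mul, norm_fourier_one, mul_one, Complex.norm_real, Real.norm_of_nonneg h0]
  exact h1

theorem continuous_comp_circle {g : ℂ → ℂ} (hg : DifferentiableOn ℂ g (Metric.ball 0 1))
    {r : ℝ} (h0 : 0 ≤ r) (h1 : r < 1) :
    Continuous fun θ : UnitAddCircle => g (r * fourier 1 θ) := by
  refine hg.continuousOn.comp_continuous (by fun_prop) fun θ => ?_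
  simpa using norm_mul_fourier_one_lt h0 h1 θ

/-- The Fourier coefficients on a circle `|z| = r` are read off from the power series. -/
theorem fourierCoeff_circle {g : ℂ → ℂ} {a : ℕ → ℂ}
    (ha : ∀ z : ℂ, ‖z‖ < 1 → HasSum (fun k => a k * z ^ k) (g z))
    {r : ℝ} (h0 : 0 ≤ r) (h1 : r < 1) (n : ℤ) :
    fourierCoeff (fun θ : UnitAddCircle => g (r * fourier 1 θ)) n =
      if 0 ≤ n then a n.toNat * r ^ n.toNat else 0 := by
  have hr : ‖(r : ℂ)‖ < 1 := by rwa [Complex.norm_real, Real.norm_of_nonneg h0]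
  have hsum : Summable fun k => ‖a k * (r : ℂ) ^ k‖ := (ha r hr).summable.norm
  have hint : ∀ k : ℕ, Integrable (fun θ : UnitAddCircle =>
      fourier (-n) θ • (a k * (r * fourier 1 θ) ^ k)) AddCircle.haarAddCircle := fun k =>
    (Continuous.integrable_of_hasCompactSupport (by fun_prop)
      (HasCompactSupport.of_compactSpace _))
  have hnorm : ∀ (k : ℕ) (θ : UnitAddCircle),
      ‖fourier (-n) θ • (a k * (r * fourier 1 θ) ^ k)‖ = ‖a k * (r : ℂ) ^ k‖ := by
    intro k θ
    have : ‖fourier (-n) θ‖ = 1 := by rw [fourier_apply]; exact Circle.norm_coe _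
    rw [norm_smul, this, one_mul, mul_pow, ← mul_assoc, norm_mul, norm_pow (fourier 1 θ : ℂ),
      norm_fourier_one, one_pow, mul_one]
  have key := hasSum_integral_of_summable_integral_norm hint (by
    simpa only [hnorm, integral_const, probReal_univ, one_smul] using hsum)
  have e1 : ∀ θ : UnitAddCircle, ∑' k : ℕ, fourier (-n) θ • (a k * (r * fourier 1 θ) ^ k) =
      fourier (-n) θ • g (r * fourier 1 θ) := fun θ =>
    ((ha _ (norm_mul_fourier_one_lt h0 h1 θ)).const_smul _).tsum_eq
  have e2 : ∀ k : ℕ, ∫ θ : UnitAddCircle, fourier (-n) θ • (a k * (r * fourier 1 θ) ^ k)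
      ∂AddCircle.haarAddCircle = if (k : ℤ) = n then a k * (r : ℂ) ^ k else 0 := by
    intro k
    have : (fun θ : UnitAddCircle => fourier (-n) θ • (a k * (r * fourier 1 θ) ^ k)) =
        fun θ => fourier (-n) θ • ((a k * (r : ℂ) ^ k) * fourier (k : ℤ) θ) := by
      ext θ
      rw [fourier_nat_eq_pow, mul_pow, mul_assoc]
    rw [this]
    change fourierCoeff (fun θ : UnitAddCircle => (a k * (r : ℂ) ^ k) * fourier (k : ℤ) θ) n = _
    rw [fourierCoeff.const_mul, fourierCoeff_fourier, Pi.single_apply]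
    simp [eq_comm]
  simp only [e1, e2] at key
  refine key.unique ?_
  split_ifs with hn
  · lift n to ℕ using hn
    have := hasSum_single (f := fun k : ℕ => if (k : ℤ) = n then a k * (r : ℂ) ^ k else 0) n
      (fun k hk => by simp [hk])
    simpa using this
  · have : ∀ k : ℕ, (k : ℤ) ≠ n := fun k hk => hn (hk ▸ Int.natCast_nonneg k)
    simp [this, hasSum_zero]

/-- Parseval's identity on the circle `|z| = r`. -/
theorem hasSum_sq_circle {g : ℂ → ℂ} (hg : DifferentiableOn ℂ g (Metric.ball 0 1)) {a : ℕ → ℂ}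
    (ha : ∀ z : ℂ, ‖z‖ < 1 → HasSum (fun k => a k * z ^ k) (g z))
    {r : ℝ} (h0 : 0 ≤ r) (h1 : r < 1) :
    HasSum (fun k => ‖a k‖ ^ 2 * (r ^ 2) ^ k)
      (∫ θ : UnitAddCircle, ‖g (r * fourier 1 θ)‖ ^ 2 ∂AddCircle.haarAddCircle) := by
  let G : C(UnitAddCircle, ℂ) := ⟨_, continuous_comp_circle hg h0 h1⟩
  have key := hasSum_sq_fourierCoeff (ContinuousMap.toLp (E := ℂ) 2 AddCircle.haarAddCircle ℂ G)
  have hG := ContinuousMap.coeFn_toLp (p := 2) (𝕜 := ℂ) AddCircle.haarAddCircle G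
  rw [integral_congr_ae (g := fun θ => ‖g (r * fourier 1 θ)‖ ^ 2)
    (by filter_upwards [hG] with θ hθ; rw [hθ]; rfl)] at key
  have hc : ∀ n : ℤ, fourierCoeff (ContinuousMap.toLp (E := ℂ) 2 AddCircle.haarAddCircle ℂ G) n =
      if 0 ≤ n then a n.toNat * r ^ n.toNat else 0 := fun n => by
    rw [fourierCoeff_toLp]
    exact fourierCoeff_circle ha h0 h1 n
  simp only [hc] at key
  have hinj : Function.Injective ((↑) : ℕ → ℤ) := Nat.cast_injective
  rw [← hinj.hasSum_iff] at key
  · refine key.congr_fun fun k => ?_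
    simp [mul_pow, abs_of_nonneg h0, ← pow_mul, mul_comm]
  · intro n hn
    have : ¬ 0 ≤ n := fun h => hn ⟨n.toNat, Int.toNat_of_nonneg h⟩
    simp [this]

/-! ### Taylor coefficients of `exp (-L f)` -/

/-- `exp (-L f)`, `f` being the conformal map onto the half-strip; for `L = log n` this is
`n^{-f}`. -/
noncomputable def expStrip (L : ℝ) (z : ℂ) : ℂ := Complex.exp (-(L * stripMap z))

theorem hasDerivAt_expStrip (L : ℝ) {z : ℂ} (hz : ‖z‖ < 1) :
    HasDerivAt (expStrip L) (expStrip L z * -(L * (4 / ((1 - z) * diskSqrt z)))) z :=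
  (((hasDerivAt_stripMap hz).const_mul (L : ℂ)).neg).cexp

theorem differentiableOn_expStrip (L : ℝ) :
    DifferentiableOn ℂ (expStrip L) (Metric.ball 0 1) := fun _ hz =>
  (hasDerivAt_expStrip L (by simpa using hz)).differentiableAt.differentiableWithinAt

theorem norm_expStrip (L : ℝ) {z : ℂ} (hz : ‖z‖ < 1) :
    ‖expStrip L z‖ = Real.exp (-L) * ‖halfDiskMap z‖ ^ (2 * L) := by
  have h0 := norm_pos_iff.2 (Complex.slitPlane_ne_zero (halfDiskMap_mem_slitPlane hz))
  rw [expStrip, Complex.norm_exp, Complex.neg_re, Complex.re_ofReal_mul, stripMap_re,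
    Real.rpow_def_of_pos h0, ← Real.exp_add]
  ring_nf

/-- The simple zero of `w` at `1` cancels the pole of `f'`, so that only the singularities
`(1 + z²)^{-1/2}` at the corners remain in the derivative. -/
theorem norm_deriv_expStrip_sq_le {L : ℝ} (hL : 1 / 2 ≤ L) {z : ℂ} (hz : ‖z‖ < 1) :
    ‖deriv (expStrip L) z‖ ^ 2 ≤ 8 * (L * Real.exp (-L)) ^ 2 * ‖(1 + z ^ 2)⁻¹‖ := by
  have hR := norm_pos_iff.2 (diskSqrt_ne_zero hz.le (one_add_sq_ne_zero hz))
  have h1 := norm_pos_iff.2 (one_sub_ne_zero_of_norm_lt hz)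
  have hw : ‖halfDiskMap z‖ ^ (2 * L) ≤ ‖1 - z‖ := by
    have := Real.rpow_le_rpow_of_exponent_ge
      (norm_pos_iff.2 (Complex.slitPlane_ne_zero (halfDiskMap_mem_slitPlane hz)))
      (norm_halfDiskMap_lt_one hz).le (show 1 ≤ 2 * L by linarith)
    rw [Real.rpow_one] at this
    exact this.trans (norm_halfDiskMap_le hz)
  have h2 : ‖deriv (expStrip L) z‖ ≤ 4 * (L * Real.exp (-L)) / ‖diskSqrt z‖ := by
    rw [(hasDerivAt_expStrip L hz).deriv, norm_mul, norm_expStrip L hz, norm_neg, norm_mul,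
      norm_div, norm_mul, Complex.norm_real, Real.norm_of_nonneg (by linarith : 0 ≤ L),
      Complex.norm_ofNat]
    calc Real.exp (-L) * ‖halfDiskMap z‖ ^ (2 * L) * (L * (4 / (‖1 - z‖ * ‖diskSqrt z‖)))
        ≤ Real.exp (-L) * ‖1 - z‖ * (L * (4 / (‖1 - z‖ * ‖diskSqrt z‖))) := by gcongr
      _ = 4 * (L * Real.exp (-L)) / ‖diskSqrt z‖ := by field_simp
  have h3 : ‖diskSqrt z‖ ^ 2 = 2 * ‖1 + z ^ 2‖ := by
    rw [← norm_pow, diskSqrt_sq, norm_mul, Complex.norm_ofNat]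
  calc ‖deriv (expStrip L) z‖ ^ 2 ≤ (4 * (L * Real.exp (-L)) / ‖diskSqrt z‖) ^ 2 := by gcongr
    _ = 8 * (L * Real.exp (-L)) ^ 2 * ‖(1 + z ^ 2)⁻¹‖ := by
      rw [div_pow, h3, norm_inv]
      have := norm_pos_iff.2 (one_add_sq_ne_zero hz)
      field_simp
      norm_num

theorem hasSum_inv_one_add_sq {z : ℂ} (hz : ‖z‖ < 1) :
    HasSum (fun k : ℕ => (Complex.I ^ k + (-Complex.I) ^ k) / 2 * z ^ k) (1 + z ^ 2)⁻¹ := by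
  have h1 := hasSum_geometric_of_norm_lt_one (ξ := Complex.I * z) (by simpa using hz)
  have h2 := hasSum_geometric_of_norm_lt_one (ξ := -Complex.I * z) (by simpa using hz)
  have h3 := (h1.add h2).mul_left (1 / 2 : ℂ)
  have e : (1 / 2 : ℂ) * ((1 - Complex.I * z)⁻¹ + (1 - -Complex.I * z)⁻¹) = (1 + z ^ 2)⁻¹ := by
    have h0 := one_add_sq_ne_zero hz
    have h4 : (1 - Complex.I * z) * (1 - -Complex.I * z) = 1 + z ^ 2 := by
      linear_combination (-z ^ 2) * Complex.I_sq
    have h5 : 1 - Complex.I * z ≠ 0 := fun h => h0 (by rw [← h4, h, zero_mul])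
    have h6 : 1 - -Complex.I * z ≠ 0 := fun h => h0 (by rw [← h4, h, mul_zero])
    rw [← h4]
    rw [neg_mul, sub_neg_eq_add] at h6 ⊢
    field_simp
    ring
  rw [e] at h3
  refine h3.congr_fun fun k => ?_
  rw [mul_pow, mul_pow]
  ring

theorem differentiableOn_inv_one_add_sq :
    DifferentiableOn ℂ (fun z : ℂ => (1 + z ^ 2)⁻¹) (Metric.ball 0 1) := fun z hz =>
  ((show DifferentiableAt ℂ (fun z : ℂ => 1 + z ^ 2) z by fun_prop).inv
    (one_add_sq_ne_zero (by simpa using hz))).differentiableWithinAt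

theorem integral_norm_inv_one_add_sq_sq_le {r : ℝ} (h0 : 0 ≤ r) (h1 : r < 1) :
    ∫ θ : UnitAddCircle, ‖(1 + ((r : ℂ) * fourier 1 θ) ^ 2)⁻¹‖ ^ 2 ∂AddCircle.haarAddCircle ≤
      (1 - r ^ 2)⁻¹ := by
  have hr : r ^ 2 < 1 := by nlinarith
  refine hasSum_le (fun k => ?_) (hasSum_sq_circle differentiableOn_inv_one_add_sq
    (fun z hz => hasSum_inv_one_add_sq hz) h0 h1) (hasSum_geometric_of_lt_one (sq_nonneg r) hr)
  have h2 : ‖(Complex.I ^ k + (-Complex.I) ^ k) / 2‖ ≤ 1 := by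
    rw [norm_div, Complex.norm_ofNat, div_le_one two_pos]
    refine (norm_add_le _ _).trans ?_
    simp only [norm_pow, norm_neg, Complex.norm_I, one_pow]
    norm_num
  exact mul_le_of_le_one_left (by positivity) (pow_le_one₀ (norm_nonneg _) h2)

/-- By the Cauchy–Schwarz inequality the mean of `1 / |1 + z²|` on `|z| = r` is at most the square
root of the mean of its square; the inequality is used here as `x ≤ (l + x² / l) / 2`. -/
theorem integral_norm_deriv_expStrip_sq_le {L : ℝ} (hL : 1 / 2 ≤ L) {r : ℝ} (h0 : 0 ≤ r)
    (h1 : r < 1) :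
    ∫ θ : UnitAddCircle, ‖deriv (expStrip L) (r * fourier 1 θ)‖ ^ 2 ∂AddCircle.haarAddCircle ≤
      8 * (L * Real.exp (-L)) ^ 2 * √(1 - r ^ 2)⁻¹ := by
  have hr : 0 < 1 - r ^ 2 := by nlinarith
  set l : ℝ := √(1 - r ^ 2)⁻¹ with hl
  have hl0 : 0 < l := Real.sqrt_pos.2 (inv_pos.2 hr)
  have hl2 : (1 - r ^ 2)⁻¹ = l ^ 2 := (Real.sq_sqrt (inv_pos.2 hr).le).symm
  have hd : DifferentiableOn ℂ (deriv (expStrip L)) (Metric.ball 0 1) :=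
    (differentiableOn_expStrip L).deriv Metric.isOpen_ball
  have c1 := continuous_comp_circle hd h0 h1
  have c2 := continuous_comp_circle differentiableOn_inv_one_add_sq h0 h1
  have int : ∀ {F : UnitAddCircle → ℝ}, Continuous F → Integrable F AddCircle.haarAddCircle :=
    fun hF => hF.integrable_of_hasCompactSupport (HasCompactSupport.of_compactSpace _)
  set K : ℝ := 8 * (L * Real.exp (-L)) ^ 2 with hK
  have hK0 : 0 ≤ K := by positivity
  have step : ∀ θ : UnitAddCircle, ‖deriv (expStrip L) (r * fourier 1 θ)‖ ^ 2 ≤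
      K / 2 * l + K / 2 * l⁻¹ * ‖(1 + ((r : ℂ) * fourier 1 θ) ^ 2)⁻¹‖ ^ 2 := by
    intro θ
    refine (norm_deriv_expStrip_sq_le hL (norm_mul_fourier_one_lt h0 h1 θ)).trans ?_
    set x := ‖(1 + ((r : ℂ) * fourier 1 θ) ^ 2)⁻¹‖
    have h2 : x ≤ 1 / 2 * (l + l⁻¹ * x ^ 2) := by
      have : l + l⁻¹ * x ^ 2 - 2 * x = l⁻¹ * (l - x) ^ 2 := by
        field_simp
        ring
      have h3 : 0 ≤ l⁻¹ * (l - x) ^ 2 := by positivity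
      linarith
    calc K * x ≤ K * (1 / 2 * (l + l⁻¹ * x ^ 2)) := by gcongr
      _ = _ := by ring
  have ic2 : Integrable (fun θ : UnitAddCircle =>
      ‖(1 + ((r : ℂ) * fourier 1 θ) ^ 2)⁻¹‖ ^ 2) AddCircle.haarAddCircle :=
    int (c2.norm.pow 2)
  refine (integral_mono (int (c1.norm.pow 2)) ((integrable_const _).add (ic2.const_mul _))
    step).trans ?_
  rw [integral_add' (integrable_const _) (ic2.const_mul _), integral_const, integral_const_mul,
    probReal_univ, one_smul]
  have h3 := integral_norm_inv_one_add_sq_sq_le h0 h1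
  rw [hl2] at h3
  calc _ ≤ K / 2 * l + K / 2 * l⁻¹ * l ^ 2 := by gcongr
    _ = K * l := by field_simp; ring

theorem sum_sq_taylorCoeff_expStrip_le {L : ℝ} (hL : 1 / 2 ≤ L) {N : ℕ} (hN : 0 < N) :
    ∑ k ∈ Finset.range N, ((k : ℝ) + 1) ^ 2 * ‖taylorCoeff (expStrip L) (k + 1)‖ ^ 2 ≤
      16 * (L * Real.exp (-L)) ^ 2 * √(2 * N) := by
  -- on the radius `r` with `r² = 1 - 1 / (2N)` the powers `r^{2k}`, `k < N`, stay above `1 / 2`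
  have hN' : (1 : ℝ) ≤ N := by exact_mod_cast hN
  set ρ : ℝ := 1 - 1 / (2 * N) with hρ
  have hρN : 1 / (2 * (N : ℝ)) ≤ 1 / 2 := by
    rw [div_le_div_iff₀ (by positivity) (by positivity)]
    linarith
  have hρ0 : 0 ≤ ρ := by linarith
  have hρ1 : ρ < 1 := by
    have : 0 < 1 / (2 * (N : ℝ)) := by positivity
    linarith
  have hr0 := Real.sqrt_nonneg ρ
  have hr1 : √ρ < 1 := by rwa [Real.sqrt_lt' one_pos, one_pow]
  have hr2 : √ρ ^ 2 = ρ := Real.sq_sqrt hρ0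
  have hd : DifferentiableOn ℂ (deriv (expStrip L)) (Metric.ball 0 1) :=
    (differentiableOn_expStrip L).deriv Metric.isOpen_ball
  have hP := hasSum_sq_circle hd (fun z hz => hasSum_taylorCoeff hd hz) hr0 hr1
  have h1 := sum_le_hasSum (Finset.range N) (fun k _ => by positivity) hP
  have h2 := h1.trans (integral_norm_deriv_expStrip_sq_le hL hr0 hr1)
  rw [hr2] at h2
  have e : (1 - ρ)⁻¹ = 2 * N := by rw [hρ]; simp
  rw [e] at h2
  have h3 : ∀ k ∈ Finset.range N,
      ((k : ℝ) + 1) ^ 2 * ‖taylorCoeff (expStrip L) (k + 1)‖ ^ 2 ≤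
        2 * (‖taylorCoeff (deriv (expStrip L)) k‖ ^ 2 * ρ ^ k) := by
    intro k hk
    have hk' : (k : ℝ) ≤ N := by exact_mod_cast (Finset.mem_range.1 hk).le
    have hb := one_add_mul_le_pow (show -2 ≤ -(1 / (2 * (N : ℝ))) by linarith) k
    have hb2 : (1 : ℝ) / 2 ≤ ρ ^ k := by
      have : (k : ℝ) * (1 / (2 * N)) ≤ 1 / 2 := by
        rw [mul_one_div, div_le_div_iff₀ (by positivity) (by positivity)]
        linarith
      rw [hρ, sub_eq_add_neg]
      linarith
    have hn : ‖((k : ℂ) + 1)‖ = (k : ℝ) + 1 := by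
      have : ((k : ℂ) + 1) = ((k + 1 : ℕ) : ℂ) := by push_cast; rfl
      rw [this, Complex.norm_natCast]
      push_cast
      rfl
    rw [taylorCoeff_deriv, norm_mul, hn, mul_pow]
    set X := ((k : ℝ) + 1) ^ 2 * ‖taylorCoeff (expStrip L) (k + 1)‖ ^ 2
    have hX : 0 ≤ X := by positivity
    nlinarith
  calc _ ≤ ∑ k ∈ Finset.range N, 2 * (‖taylorCoeff (deriv (expStrip L)) k‖ ^ 2 * ρ ^ k) :=
        Finset.sum_le_sum h3
    _ ≤ 2 * (8 * (L * Real.exp (-L)) ^ 2 * √(2 * N)) := by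
        rw [← Finset.mul_sum]
        linarith
    _ = _ := by ring

/-- A dyadic decomposition and the Cauchy–Schwarz inequality on each block `[2^j, 2^{j+1})`, whose
contribution is `O(2^{-j/4})`. -/
theorem summable_sqrt_of_sum_sq_mul_le {A : ℕ → ℝ} (hA : ∀ k, 0 ≤ A k) {B : ℝ}
    (hB : ∀ N : ℕ, 0 < N → ∑ k ∈ Finset.range N, ((k : ℝ) + 1) ^ 2 * A k ≤ B * √N) :
    Summable fun k => √(A k) := by
  set q : ℝ := (√(√2))⁻¹ with hq
  have hs2 : (1 : ℝ) < √2 := by rw [Real.lt_sqrt] <;> norm_num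
  have hss2 : (1 : ℝ) < √(√2) := by
    rw [Real.lt_sqrt zero_le_one, one_pow]
    exact hs2
  have hq0 : 0 < q := inv_pos.2 (one_pos.trans hss2)
  have hq1 : q < 1 := inv_lt_one_of_one_lt₀ hss2
  have hq4 : q ^ 4 = 1 / 2 := by
    have : √(√2) ^ 4 = 2 := by
      rw [show 4 = 2 * 2 from rfl, pow_mul, Real.sq_sqrt (Real.sqrt_nonneg _),
        Real.sq_sqrt zero_le_two]
    rw [hq, inv_pow, this, one_div]
  have hB0 : 0 ≤ B := by
    have := hB 1 one_pos
    simp at this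
    exact (hA 0).trans this
  set D : ℝ := √(2 * B) with hD
  have hD0 : 0 ≤ D := Real.sqrt_nonneg _
  have block : ∀ j : ℕ, ∑ k ∈ Finset.Ico (2 ^ j) (2 ^ (j + 1)), √(A k) ≤ D * q ^ j := by
    intro j
    have hcard : ((Finset.Ico (2 ^ j) (2 ^ (j + 1))).card : ℝ) = 2 ^ j := by
      rw [Nat.card_Ico, pow_succ, mul_two, Nat.add_sub_cancel]
      push_cast
      rfl
    have h1 := sq_sum_le_card_mul_sum_sq (s := Finset.Ico (2 ^ j) (2 ^ (j + 1)))
      (f := fun k => √(A k))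
    simp only [Real.sq_sqrt (hA _), hcard] at h1
    have h2 : (2 ^ j) ^ 2 * ∑ k ∈ Finset.Ico (2 ^ j) (2 ^ (j + 1)), A k ≤
        B * √((2 : ℝ) ^ (j + 1)) := by
      have h3 := hB (2 ^ (j + 1)) (by positivity)
      push_cast at h3
      refine le_trans ?_ h3
      rw [Finset.mul_sum]
      refine (Finset.sum_le_sum fun k hk => ?_).trans
        (Finset.sum_le_sum_of_subset_of_nonneg (fun k hk => ?_) fun k _ _ =>
          mul_nonneg (sq_nonneg ((k : ℝ) + 1)) (hA k))
      · have hk1 : (2 : ℝ) ^ j ≤ k := by exact_mod_cast (Finset.mem_Ico.1 hk).1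
        have hp : (0 : ℝ) < 2 ^ j := by positivity
        gcongr
        · exact hA k
        · linarith
      · exact Finset.mem_range.2 (Finset.mem_Ico.1 hk).2
    have hsq : √((2 : ℝ) ^ (j + 1)) ≤ 2 * 2 ^ j * q ^ (2 * j) := by
      rw [Real.sqrt_le_left (by positivity)]
      have e : (2 * 2 ^ j * q ^ (2 * j)) ^ 2 = 2 ^ (j + 1) * (2 * (2 ^ j * (q ^ 4) ^ j)) := by
        ring
      rw [e, hq4, ← mul_pow]
      norm_num
    refine (sq_le_sq₀ (Finset.sum_nonneg fun _ _ => Real.sqrt_nonneg _) (by positivity)).1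
      (h1.trans ?_)
    have hp : (0 : ℝ) < 2 ^ j := by positivity
    rw [mul_pow, hD, Real.sq_sqrt (by positivity)]
    refine le_of_mul_le_mul_left ?_ hp
    calc 2 ^ j * (2 ^ j * ∑ k ∈ Finset.Ico (2 ^ j) (2 ^ (j + 1)), A k)
        = (2 ^ j) ^ 2 * ∑ k ∈ Finset.Ico (2 ^ j) (2 ^ (j + 1)), A k := by ring
      _ ≤ B * √((2 : ℝ) ^ (j + 1)) := h2
      _ ≤ B * (2 * 2 ^ j * q ^ (2 * j)) := by gcongr
      _ = 2 ^ j * (2 * B * (q ^ j) ^ 2) := by ring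
  have total : ∀ j : ℕ, ∑ k ∈ Finset.range (2 ^ j), √(A k) ≤
      √(A 0) + D * ∑ i ∈ Finset.range j, q ^ i := by
    intro j
    induction j with
    | zero => simp
    | succ j ih =>
      rw [Finset.sum_range_succ, mul_add,
        ← Finset.sum_range_add_sum_Ico _ (Nat.pow_le_pow_right two_pos j.le_succ)]
      linarith [block j]
  refine summable_of_sum_range_le (c := √(A 0) + D * (1 - q)⁻¹) (fun k => Real.sqrt_nonneg _)
    fun n => ?_
  calc ∑ k ∈ Finset.range n, √(A k) ≤ ∑ k ∈ Finset.range (2 ^ n), √(A k) :=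
        Finset.sum_le_sum_of_subset_of_nonneg
          (Finset.range_mono Nat.lt_two_pow_self.le) fun _ _ _ => Real.sqrt_nonneg _
    _ ≤ _ := total n
    _ ≤ _ := by
      gcongr
      exact sum_le_hasSum _ (fun i _ => by positivity) (hasSum_geometric_of_lt_one hq0.le hq1)

theorem summable_log_div_sq : Summable fun n : ℕ+ => (Real.log n / n) ^ 2 := by
  have h : Summable fun n : ℕ => 16 * ((n : ℝ) ^ (3 / 2 : ℝ))⁻¹ :=
    (Real.summable_nat_rpow_inv.2 (by norm_num)).mul_left 16
  refine Summable.of_nonneg_of_le (fun n => sq_nonneg _) (fun n => ?_)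
    (h.comp_injective PNat.coe_injective)
  have hn : (1 : ℝ) ≤ (n : ℕ) := by exact_mod_cast one_le (a := n)
  have hn0 : (0 : ℝ) < (n : ℕ) := by linarith
  have h1 := Real.log_le_rpow_div hn0.le (show (0 : ℝ) < 1 / 4 by norm_num)
  have h2 : Real.log n ^ 2 ≤ 16 * ((n : ℕ) : ℝ) ^ (1 / 2 : ℝ) := by
    calc Real.log n ^ 2 ≤ (((n : ℕ) : ℝ) ^ (1 / 4 : ℝ) / (1 / 4)) ^ 2 := by
          have := Real.log_nonneg hn
          gcongr
      _ = _ := by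
        rw [div_pow, ← Real.rpow_mul_natCast hn0.le]
        norm_num
        ring
  rw [Function.comp_apply, div_pow, ← Real.rpow_neg hn0.le, div_le_iff₀ (by positivity)]
  refine h2.trans (le_of_eq ?_)
  rw [mul_assoc, ← Real.rpow_natCast _ 2, ← Real.rpow_add hn0]
  norm_num

theorem expStrip_zero : expStrip 0 = 1 := by
  ext z
  simp [expStrip]

theorem taylorCoeff_one_succ (k : ℕ) : taylorCoeff (1 : ℂ → ℂ) (k + 1) = 0 := by
  have : iteratedDeriv (k + 1) (1 : ℂ → ℂ) = fun _ => 0 := by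
    change iteratedDeriv (k + 1) (fun _ => (1 : ℂ)) = _
    ext z
    simp [iteratedDeriv_const]
  simp [taylorCoeff, this]

theorem sum_sq_taylorCoeff_natPow_le (n : ℕ+) {N : ℕ} (hN : 0 < N) :
    ∑ k ∈ Finset.range N,
        ((k : ℝ) + 1) ^ 2 * ‖taylorCoeff (expStrip (Real.log n)) (k + 1)‖ ^ 2 ≤
      16 * (Real.log n / n) ^ 2 * √(2 * N) := by
  rcases (one_le (a := n)).eq_or_lt with h | h
  · simp [← h, expStrip_zero, taylorCoeff_one_succ]
  · have hn : (2 : ℝ) ≤ (n : ℕ) := by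
      have : 1 < (n : ℕ) := h
      exact_mod_cast this
    have hL : 1 / 2 ≤ Real.log n := by
      have h1 := Real.log_le_log two_pos hn
      have h2 := Real.log_two_gt_d9
      norm_num at h2 ⊢
      linarith
    have := sum_sq_taylorCoeff_expStrip_le hL hN
    rwa [Real.exp_neg, Real.exp_log (by linarith), ← div_eq_mul_inv] at this

/-- The `k`-th Taylor coefficients of all the functions `n^{-f}` have a common bound, and these
bounds are summable over `k`; the bound is the `ℓ²` norm over `n`. -/
theorem exists_summable_bound_taylorCoeff :
    ∃ M : ℕ → ℝ, Summable M ∧ ∀ (n : ℕ+) (k : ℕ),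
      ‖taylorCoeff (expStrip (Real.log n)) k‖ ≤ M k := by
  set c : ℕ+ → ℕ → ℝ := fun n k => ‖taylorCoeff (expStrip (Real.log n)) (k + 1)‖ ^ 2 with hc
  have hl := summable_log_div_sq
  have hsum : ∀ k, Summable fun n => c n k := by
    intro k
    refine Summable.of_nonneg_of_le (fun n => sq_nonneg _) (fun n => ?_)
      (hl.mul_left (16 * √(2 * (k + 1 : ℕ))))
    have h1 := sum_sq_taylorCoeff_natPow_le n k.succ_pos
    have h2 := Finset.single_le_sum (f := fun k : ℕ => ((k : ℝ) + 1) ^ 2 * c n k)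
      (fun i _ => by positivity) (Finset.self_mem_range_succ k)
    have h3 : c n k ≤ ((k : ℝ) + 1) ^ 2 * c n k :=
      le_mul_of_one_le_left (sq_nonneg _) (one_le_pow₀ (by
        have : (0 : ℝ) ≤ k := k.cast_nonneg
        linarith))
    calc c n k ≤ 16 * (Real.log n / n) ^ 2 * √(2 * (k + 1 : ℕ)) := h3.trans (h2.trans h1)
      _ = _ := by ring
  set A : ℕ → ℝ := fun k => ∑' n, c n k with hA
  have hA0 : ∀ k, 0 ≤ A k := fun k => tsum_nonneg fun n => sq_nonneg _
  have hAs : Summable fun k => √(A k) := by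
    refine summable_sqrt_of_sum_sq_mul_le hA0
      (B := 16 * √2 * ∑' n : ℕ+, (Real.log n / n) ^ 2) fun N hN => ?_
    simp only [hA, ← tsum_mul_left]
    rw [← Summable.tsum_finsetSum fun k _ => (hsum k).mul_left _, ← tsum_mul_right]
    refine Summable.tsum_le_tsum (fun n => ?_) (summable_sum fun k _ => (hsum k).mul_left _)
      ((hl.mul_left _).mul_right _)
    refine (sum_sq_taylorCoeff_natPow_le n hN).trans (le_of_eq ?_)
    rw [Real.sqrt_mul zero_le_two]
    ring
  refine ⟨fun k => k.casesOn 1 fun k => √(A k), (summable_nat_add_iff 1).1 hAs, fun n k => ?_⟩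
  cases k with
  | zero =>
    simp only [taylorCoeff_zero]
    have h0 : ‖(0 : ℂ)‖ < 1 := by simp
    have hn : 0 ≤ Real.log n := Real.log_natCast_nonneg _
    rw [norm_expStrip _ h0]
    exact mul_le_one₀ (Real.exp_le_one_iff.2 (by linarith)) (by positivity)
      (Real.rpow_le_one (norm_nonneg _) (norm_halfDiskMap_lt_one h0).le (by linarith))
  | succ k =>
    exact Real.le_sqrt_of_sq_le ((hsum k).le_tsum n fun m _ => sq_nonneg _)

/-! ### Nuclear operators -/

section Nuclear

variable {X Y : Type*} [NormedAddCommGroup X] [NormedSpace ℂ X] [NormedAddCommGroup Y]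
  [NormedSpace ℂ Y]

theorem summable_smulRight [CompleteSpace Y] {ξ : ℕ → StrongDual ℂ X} {y : ℕ → Y}
    (h : Summable fun k => ‖ξ k‖ * ‖y k‖) : Summable fun k => (ξ k).smulRight (y k) :=
  Summable.of_norm (by simpa only [ContinuousLinearMap.norm_smulRight_apply] using h)

theorem isCompactOperator_tsum_smulRight [CompleteSpace Y] {ξ : ℕ → StrongDual ℂ X} {y : ℕ → Y}
    (h : Summable fun k => ‖ξ k‖ * ‖y k‖) :
    IsCompactOperator (∑' k, (ξ k).smulRight (y k) : X →L[ℂ] Y) := by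
  refine isCompactOperator_of_tendsto (summable_smulRight h).hasSum
    (Eventually.of_forall fun s => ?_)
  refine (compactOperator (RingHom.id ℂ) X Y).sum_mem fun k _ => ?_
  exact (isCompactOperator_of_locallyCompactSpace_dom (ξ k)).clm_comp
    (ContinuousLinearMap.toSpanSingleton ℂ (y k))

theorem isAbsolutelySumming_tsum_smulRight [CompleteSpace Y] {ξ : ℕ → StrongDual ℂ X} {y : ℕ → Y}
    (h : Summable fun k => ‖ξ k‖ * ‖y k‖) :
    IsAbsolutelySumming (∑' k, (ξ k).smulRight (y k) : X →L[ℂ] Y) := by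
  have h0 : 0 ≤ ∑' k, ‖ξ k‖ * ‖y k‖ := tsum_nonneg fun k => by positivity
  refine ⟨∑' k, ‖ξ k‖ * ‖y k‖ + 1, by linarith, fun n x => ?_⟩
  simp only [Real.rpow_one, div_one]
  set S : ℝ := ⨆ η : Metric.closedBall (0 : StrongDual ℂ X) 1, ∑ i, ‖η.1 (x i)‖ with hS
  have hbdd : BddAbove (Set.range fun η : Metric.closedBall (0 : StrongDual ℂ X) 1 =>
      ∑ i, ‖η.1 (x i)‖) := by
    refine ⟨∑ i, ‖x i‖, ?_⟩
    rintro _ ⟨η, rfl⟩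
    exact Finset.sum_le_sum fun i _ =>
      (η.1.le_of_opNorm_le (mem_closedBall_zero_iff.1 η.2) (x i)).trans_eq (one_mul _)
  have hS0 : 0 ≤ S := Real.iSup_nonneg fun η => Finset.sum_nonneg fun i _ => norm_nonneg _
  have hξ : ∀ η : StrongDual ℂ X, ∑ i, ‖η (x i)‖ ≤ ‖η‖ * S := by
    intro η
    rcases eq_or_ne η 0 with rfl | hη
    · simp
    have hη' : 0 < ‖η‖ := norm_pos_iff.2 hη
    have hmem : ((‖η‖⁻¹ : ℝ) : ℂ) • η ∈ Metric.closedBall (0 : StrongDual ℂ X) 1 := by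
      rw [mem_closedBall_zero_iff, norm_smul, Complex.norm_real, norm_inv, norm_norm,
        inv_mul_cancel₀ hη'.ne']
    have h1 := le_ciSup hbdd ⟨_, hmem⟩
    have h2 : ∑ i, ‖(((‖η‖⁻¹ : ℝ) : ℂ) • η) (x i)‖ = ‖η‖⁻¹ * ∑ i, ‖η (x i)‖ := by
      rw [Finset.mul_sum]
      refine Finset.sum_congr rfl fun i _ => ?_
      rw [smul_apply, norm_smul, Complex.norm_real, norm_inv, norm_norm]
    simp only [h2] at h1
    rwa [inv_mul_le_iff₀ hη'] at h1
  have happ : ∀ z : X, HasSum (fun k => ξ k z • y k)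
      ((∑' k, (ξ k).smulRight (y k) : X →L[ℂ] Y) z) := fun z =>
    (summable_smulRight h).hasSum.mapL (ContinuousLinearMap.apply ℂ Y z)
  have hsm : ∀ i, Summable fun k => ‖ξ k (x i)‖ * ‖y k‖ := fun i =>
    Summable.of_nonneg_of_le (fun k => by positivity)
      (fun k => (mul_le_mul_of_nonneg_right ((ξ k).le_opNorm (x i)) (norm_nonneg _)).trans
        (le_of_eq (by ring))) (h.mul_left ‖x i‖)
  calc ∑ i, ‖(∑' k, (ξ k).smulRight (y k) : X →L[ℂ] Y) (x i)‖
      ≤ ∑ i, ∑' k, ‖ξ k (x i)‖ * ‖y k‖ := by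
        refine Finset.sum_le_sum fun i _ => ?_
        rw [← (happ (x i)).tsum_eq]
        simp only [← norm_smul]
        exact norm_tsum_le_tsum_norm (by simpa only [norm_smul] using hsm i)
    _ = ∑' k, (∑ i, ‖ξ k (x i)‖) * ‖y k‖ := by
        rw [← Summable.tsum_finsetSum fun i _ => hsm i]
        simp only [Finset.sum_mul]
    _ ≤ ∑' k, ‖ξ k‖ * ‖y k‖ * S := by
        refine Summable.tsum_le_tsum (fun k => ?_) ?_ (h.mul_right S)
        · calc _ ≤ ‖ξ k‖ * S * ‖y k‖ := by gcongr; exact hξ _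
            _ = _ := by ring
        · simp only [Finset.sum_mul]
          exact summable_sum fun i _ => hsm i
    _ = (∑' k, ‖ξ k‖ * ‖y k‖) * S := tsum_mul_right
    _ ≤ (∑' k, ‖ξ k‖ * ‖y k‖ + 1) * S := by gcongr; linarith

end Nuclear

/-! ### The Wiener algebra as an `ℓ¹` space -/

theorem norm_natCast_cpow_neg_le_one (n : ℕ+) {s : ℂ} (hs : s ∈ rightHalfPlane 0) :
    ‖((n : ℕ) : ℂ) ^ (-s)‖ ≤ 1 := by
  have hs' : 0 < s.re := hs
  rw [Complex.norm_natCast_cpow_of_pos n.pos]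
  exact Real.rpow_le_one_of_one_le_of_nonpos (by exact_mod_cast one_le (a := n))
    (by simpa using hs'.le)

namespace WienerAlgebra

theorem hasWienerSeries_tsum {a : ℕ+ → ℂ} (ha : Summable fun n => ‖a n‖) :
    HasWienerSeries (fun s => ∑' n, dirichletTerm a s n) a :=
  ⟨ha, fun s => by
    refine (Summable.of_norm_bounded ha fun n => ?_).hasSum
    rw [dirichletTerm, norm_mul]
    exact mul_le_of_le_one_right (norm_nonneg _) (norm_natCast_cpow_neg_le_one n s.2)⟩

/-- The element of `𝒜⁺` with given summable coefficients. -/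
noncomputable def ofCoeff (a : ℕ+ → ℂ) (ha : Summable fun n => ‖a n‖) : WienerAlgebra :=
  ⟨fun s => ∑' n, dirichletTerm a s n, a, hasWienerSeries_tsum ha⟩

theorem coeff_eq {f : WienerAlgebra} {a : ℕ+ → ℂ} (h : HasWienerSeries f a) : f.coeff = a :=
  f.hasWienerSeries_coeff.unique h

theorem hasWienerSeries_ofCoeff {a : ℕ+ → ℂ} (ha : Summable fun n => ‖a n‖) :
    HasWienerSeries (ofCoeff a ha) a :=
  hasWienerSeries_tsum ha

theorem coeff_ofCoeff {a : ℕ+ → ℂ} (ha : Summable fun n => ‖a n‖) : (ofCoeff a ha).coeff = a :=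
  coeff_eq (hasWienerSeries_ofCoeff ha)

/-- The isometry of `𝒜⁺` onto `ℓ¹` given by the coefficients. -/
noncomputable def coeffIsometry : WienerAlgebra →ₗᵢ[ℂ] lp (fun _ : ℕ+ => ℂ) 1 where
  toFun f := ⟨f.coeff, show Memℓp f.coeff 1 by
    rw [memℓp_gen_iff (by simp)]
    simpa using f.hasWienerSeries_coeff.1⟩
  map_add' f g := lp.ext (coeff_add f g)
  map_smul' c f := lp.ext (coeff_smul c f)
  norm_map' f := by
    rw [lp.norm_eq_tsum_rpow (by simp)]
    simp [norm_def]

theorem coeffIsometry_surjective : Function.Surjective coeffIsometry := by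
  intro a
  have ha : Summable fun n => ‖a n‖ := by
    have := lp.memℓp a
    rw [memℓp_gen_iff (by simp)] at this
    simpa using this
  exact ⟨ofCoeff a ha, Subtype.ext (coeff_ofCoeff ha)⟩

instance : CompleteSpace WienerAlgebra :=
  (LinearIsometryEquiv.ofSurjective coeffIsometry
    coeffIsometry_surjective).toIsometryEquiv.completeSpace_iff.2 inferInstance

theorem summable_coeff_mul {c : ℕ+ → ℂ} {M : ℝ} (hc : ∀ n, ‖c n‖ ≤ M) (f : WienerAlgebra) :
    Summable fun n => f.coeff n * c n :=
  Summable.of_norm_bounded (f.hasWienerSeries_coeff.1.mul_right M) fun n => by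
    rw [norm_mul]
    exact mul_le_mul_of_nonneg_left (hc n) (norm_nonneg _)

theorem norm_tsum_coeff_mul_le {c : ℕ+ → ℂ} {M : ℝ} (hc : ∀ n, ‖c n‖ ≤ M) (f : WienerAlgebra) :
    ‖∑' n, f.coeff n * c n‖ ≤ M * ‖f‖ := by
  rw [norm_def, mul_comm, ← tsum_mul_right]
  exact tsum_of_norm_bounded (f.hasWienerSeries_coeff.1.mul_right M).hasSum fun n => by
    rw [norm_mul]
    exact mul_le_mul_of_nonneg_left (hc n) (norm_nonneg _)

/-- The functional `f ↦ ∑ a_n c_n` on `𝒜⁺`, for a bounded sequence `c`. -/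
noncomputable def pairing (c : ℕ+ → ℂ) (M : ℝ) (hc : ∀ n, ‖c n‖ ≤ M) :
    StrongDual ℂ WienerAlgebra :=
  LinearMap.mkContinuous
    { toFun := fun f => ∑' n, f.coeff n * c n
      map_add' := fun f g => by
        rw [← (summable_coeff_mul hc f).tsum_add (summable_coeff_mul hc g)]
        simp [coeff_add, add_mul]
      map_smul' := fun z f => by
        rw [RingHom.id_apply, smul_eq_mul, ← tsum_mul_left]
        simp [coeff_smul, mul_assoc] } M (norm_tsum_coeff_mul_le hc)

theorem pairing_apply {c : ℕ+ → ℂ} {M : ℝ} (hc : ∀ n, ‖c n‖ ≤ M) (f : WienerAlgebra) :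
    pairing c M hc f = ∑' n, f.coeff n * c n := rfl

theorem norm_pairing_le {c : ℕ+ → ℂ} {M : ℝ} (hc : ∀ n, ‖c n‖ ≤ M) : ‖pairing c M hc‖ ≤ M :=
  LinearMap.mkContinuous_norm_le _ ((norm_nonneg _).trans (hc 1)) _

/-- Evaluation at `s` as a continuous functional on `𝒜⁺`. -/
noncomputable def eval (s : rightHalfPlane 0) : StrongDual ℂ WienerAlgebra :=
  pairing (fun n => ((n : ℕ) : ℂ) ^ (-s.1)) 1 fun n => norm_natCast_cpow_neg_le_one n s.2

theorem eval_apply (s : rightHalfPlane 0) (f : WienerAlgebra) : eval s f = f s :=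
  (f.hasWienerSeries_coeff.2 s).tsum_eq

theorem norm_apply_le (f : WienerAlgebra) (s : rightHalfPlane 0) : ‖f s‖ ≤ ‖f‖ := by
  rw [← eval_apply]
  simpa using (eval s).le_of_opNorm_le (norm_pairing_le _) f

theorem hasSum_single_coeff (m : ℕ+) : HasSum (fun n => ‖Pi.single (M := fun _ => ℂ) m 1 n‖) 1 := by
  have := hasSum_single (f := fun n => ‖Pi.single (M := fun _ : ℕ+ => ℂ) m 1 n‖) m
    fun n hn => by simp [hn]
  simpa using this

/-- The monomial `m^{-s}` in `𝒜⁺`. -/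
noncomputable def monomial (m : ℕ+) : WienerAlgebra :=
  ofCoeff (Pi.single m 1) (hasSum_single_coeff m).summable

theorem norm_monomial (m : ℕ+) : ‖monomial m‖ = 1 := by
  rw [norm_def, monomial, coeff_ofCoeff, (hasSum_single_coeff m).tsum_eq]

theorem monomial_apply (m : ℕ+) (s : rightHalfPlane 0) :
    monomial m s = ((m : ℕ) : ℂ) ^ (-s.1) := by
  refine ((hasWienerSeries_ofCoeff (hasSum_single_coeff m).summable).2 s).unique ?_
  have := hasSum_single (f := dirichletTerm (Pi.single m 1) s) m
    fun n hn => by simp [dirichletTerm, hn]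
  simpa [dirichletTerm] using this

end WienerAlgebra

/-! ### The composition operator -/

theorem norm_two_cpow_neg_lt {s : ℂ} (hs : s ∈ rightHalfPlane 0) : ‖(2 : ℂ) ^ (-s)‖ < 1 := by
  have hs' : 0 < s.re := hs
  have := Complex.norm_cpow_eq_rpow_re_of_pos (x := 2) two_pos (-s)
  rw [Complex.ofReal_ofNat] at this
  rw [this]
  exact Real.rpow_lt_one_of_one_lt_of_neg one_lt_two (by simpa using hs')

theorem two_pow_cpow_neg (k : ℕ) (s : ℂ) :
    ((((2 : ℕ+) ^ k : ℕ+) : ℕ) : ℂ) ^ (-s) = ((2 : ℂ) ^ (-s)) ^ k := by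
  induction k with
  | zero => simp
  | succ k ih =>
    rw [pow_succ, PNat.mul_coe, Nat.cast_mul, Complex.natCast_mul_natCast_cpow, ih, pow_succ]
    norm_num

theorem natCast_cpow_neg_stripMap (n : ℕ+) (z : ℂ) :
    ((n : ℕ) : ℂ) ^ (-stripMap z) = expStrip (Real.log n) z := by
  rw [Complex.cpow_def_of_ne_zero (by exact_mod_cast n.ne_zero), expStrip, Complex.ofReal_log
    (Nat.cast_nonneg _), Complex.ofReal_natCast, mul_neg]

/-- The function `f(2^{-s})`, `f` being the conformal map onto the half-strip. -/
noncomputable def stripSeries (s : ℂ) : ℂ := stripMap (2 ^ (-s))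

theorem stripSeries_mem {s : ℂ} (hs : s ∈ rightHalfPlane 0) :
    stripSeries s ∈ halfStrip :=
  mapsTo_stripMap (by simpa using norm_two_cpow_neg_lt hs)

theorem mapsTo_stripSeries :
    Set.MapsTo stripSeries (rightHalfPlane 0) (rightHalfPlane 0) := fun _ hs =>
  one_pos.trans (stripSeries_mem hs).1

theorem WienerAlgebra.tsum_smulRight_apply {ξ : ℕ → StrongDual ℂ WienerAlgebra}
    {y : ℕ → WienerAlgebra} (h : Summable fun k => ‖ξ k‖ * ‖y k‖) (f : WienerAlgebra)
    (s : rightHalfPlane 0) :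
    (∑' k, (ξ k).smulRight (y k) : WienerAlgebra →L[ℂ] WienerAlgebra) f s =
      ∑' k, ξ k f * y k s := by
  have := ((summable_smulRight h).hasSum.mapL
    (ContinuousLinearMap.apply ℂ WienerAlgebra f)).mapL (WienerAlgebra.eval s)
  rw [ContinuousLinearMap.apply_apply, WienerAlgebra.eval_apply] at this
  rw [← this.tsum_eq]
  refine tsum_congr fun k => ?_
  rw [ContinuousLinearMap.apply_apply, ContinuousLinearMap.smulRight_apply, map_smul,
    WienerAlgebra.eval_apply, smul_eq_mul]

/-- The double series for `∑ aₙ n^{-f(z)}` may be summed over the powers of `z` last. -/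
theorem tsum_tsum_taylorCoeff {a : ℕ+ → ℂ} (ha : Summable fun n => ‖a n‖) {M : ℕ → ℝ}
    (hM : Summable M)
    (hc : ∀ (n : ℕ+) (k : ℕ), ‖taylorCoeff (expStrip (Real.log n)) k‖ ≤ M k) {z : ℂ}
    (hz : ‖z‖ < 1) :
    ∑' k, (∑' n, a n * taylorCoeff (expStrip (Real.log n)) k) * z ^ k =
      ∑' n, dirichletTerm a (stripMap z) n := by
  have hsum : Summable (Function.uncurry fun (k : ℕ) (n : ℕ+) =>
      a n * (taylorCoeff (expStrip (Real.log n)) k * z ^ k)) := by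
    refine Summable.of_norm_bounded (hM.mul_of_nonneg ha
      (fun k => (norm_nonneg _).trans (hc 1 k)) fun n => norm_nonneg _) fun p => ?_
    rw [Function.uncurry, norm_mul, norm_mul, norm_pow, mul_comm]
    refine mul_le_mul_of_nonneg_right ?_ (norm_nonneg _)
    exact (mul_le_of_le_one_right (norm_nonneg _) (pow_le_one₀ (norm_nonneg _) hz.le)).trans
      (hc p.2 p.1)
  have h2 : ∀ k, (∑' n, a n * taylorCoeff (expStrip (Real.log n)) k) * z ^ k =
      ∑' n, a n * (taylorCoeff (expStrip (Real.log n)) k * z ^ k) := by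
    intro k
    rw [← tsum_mul_right]
    simp only [mul_assoc]
  rw [tsum_congr h2, ← hsum.tsum_comm]
  refine tsum_congr fun n => ?_
  rw [tsum_mul_left, (hasSum_taylorCoeff (differentiableOn_expStrip _) hz).tsum_eq, dirichletTerm,
    natCast_cpow_neg_stripMap]

/-- Expanding every `n^{-f}` in powers of `2^{-s}` exhibits the composition operator as the nuclear
operator `∑ₖ ξₖ ⊗ 2^{-ks}`, where `ξₖ` collects the `k`-th coefficients. -/
theorem exists_compositionOperator : ∃ C : WienerAlgebra →L[ℂ] WienerAlgebra,
    IsCompositionOperator stripSeries mapsTo_stripSeries C ∧ IsCompactOperator C ∧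
      IsAbsolutelySumming C := by
  obtain ⟨M, hM, hc⟩ := exists_summable_bound_taylorCoeff
  obtain ⟨ξ, hξ, hξM⟩ : ∃ ξ : ℕ → StrongDual ℂ WienerAlgebra,
      (∀ k f, ξ k f = ∑' n, f.coeff n * taylorCoeff (expStrip (Real.log n)) k) ∧
        ∀ k, ‖ξ k‖ ≤ M k :=
    ⟨fun k => WienerAlgebra.pairing _ (M k) fun n => hc n k,
      fun k f => WienerAlgebra.pairing_apply _ f, fun k => WienerAlgebra.norm_pairing_le _⟩
  have h : Summable fun k => ‖ξ k‖ * ‖WienerAlgebra.monomial (2 ^ k)‖ := by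
    refine Summable.of_nonneg_of_le (fun k => by positivity) (fun k => ?_) hM
    rw [WienerAlgebra.norm_monomial, mul_one]
    exact hξM k
  refine ⟨∑' k, (ξ k).smulRight (WienerAlgebra.monomial (2 ^ k)), fun f s => ?_,
    isCompactOperator_tsum_smulRight h, isAbsolutelySumming_tsum_smulRight h⟩
  rw [WienerAlgebra.tsum_smulRight_apply h]
  simp only [hξ, WienerAlgebra.monomial_apply, two_pow_cpow_neg]
  rw [tsum_tsum_taylorCoeff f.hasWienerSeries_coeff.1 hM hc (norm_two_cpow_neg_lt s.2)]
  exact (f.hasWienerSeries_coeff.2 (mapsTo_stripSeries.restrict _ _ _ s)).tsum_eq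

theorem exists_stripSeries_eq {ζ : ℂ} (hζ : ζ ∈ halfStrip) (h0 : ζ ≠ stripMap 0) :
    ∃ s ∈ rightHalfPlane 0, stripSeries s = ζ := by
  obtain ⟨z, hz, rfl⟩ := surjOn_stripMap hζ
  have hz0 : z ≠ 0 := fun h => h0 (by rw [h])
  have hz1 : ‖z‖ < 1 := by simpa using hz
  have hl : (0 : ℝ) < Real.log 2 := Real.log_pos one_lt_two
  have hl2 : Complex.log 2 = (Real.log 2 : ℝ) := by
    rw [Complex.ofReal_log zero_le_two, Complex.ofReal_ofNat]
  have hl3 : Complex.log 2 ≠ 0 := by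
    rw [hl2]
    exact_mod_cast hl.ne'
  refine ⟨-(Complex.log z / Complex.log 2), ?_, ?_⟩
  · have h1 := Real.log_neg (norm_pos_iff.2 hz0) hz1
    have : (-(Complex.log z / Complex.log 2)).re = -(Real.log ‖z‖ / Real.log 2) := by
      rw [hl2, Complex.neg_re, Complex.div_ofReal_re, Complex.log_re]
    change (0 : ℝ) < _
    rw [this, neg_pos]
    exact div_neg_of_neg_of_pos h1 hl
  · rw [stripSeries, neg_neg, Complex.cpow_def_of_ne_zero two_ne_zero, mul_div_cancel₀ _ hl3,
      Complex.exp_log hz0]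

theorem stripSeries_notMem_wiener :
    (rightHalfPlane 0).domRestrict stripSeries ∉ wienerSubmodule := by
  intro hmem
  let F : WienerAlgebra := ⟨_, hmem⟩
  obtain ⟨x, hx⟩ : ∃ x : ℝ, 1 < x ∧ ‖F‖ < x ∧ ‖stripMap 0‖ < x :=
    ⟨1 + ‖F‖ + ‖stripMap 0‖ + 1, by
      have := norm_nonneg F
      have := norm_nonneg (stripMap 0)
      refine ⟨?_, ?_, ?_⟩ <;> linarith⟩
  obtain ⟨h1, h2, h3⟩ := hx
  have hnx : ‖(x : ℂ)‖ = x := by rw [Complex.norm_real, Real.norm_of_nonneg (by linarith)]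
  obtain ⟨s, hs, e⟩ := exists_stripSeries_eq (ζ := (x : ℂ))
    ⟨by simpa using h1, by simpa using Real.pi_pos⟩ (fun h => by rw [← h, hnx] at h3; exact h3.false)
  have h4 := WienerAlgebra.norm_apply_le F ⟨s, hs⟩
  have h5 : F ⟨s, hs⟩ = x := e
  rw [h5, hnx] at h4
  linarith

/-! ### Boundary values on the unit circle -/

theorem volume_unitAddCircle :
    (volume : Measure UnitAddCircle) = AddCircle.haarAddCircle := by
  rw [AddCircle.volume_eq_smul_haarAddCircle, ENNReal.ofReal_one, one_smul]

instance : NullSingletonClass (AddCircle.haarAddCircle : Measure UnitAddCircle) := by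
  refine ⟨fun x => ?_⟩
  rw [← volume_unitAddCircle, ← Metric.closedBall_zero, AddCircle.volume_closedBall]
  simp

theorem ae_fourier_one_ne (c : ℂ) :
    ∀ᵐ θ : UnitAddCircle ∂AddCircle.haarAddCircle, (fourier 1 θ : ℂ) ≠ c := by
  have hs : {θ : UnitAddCircle | (fourier 1 θ : ℂ) = c}.Subsingleton := by
    intro θ hθ θ' hθ'
    have h : (fourier 1 θ : ℂ) = fourier 1 θ' := Eq.trans hθ hθ'.symm
    rw [fourier_one, fourier_one] at h
    exact AddCircle.injective_toCircle one_ne_zero (Circle.ext h)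
  have := hs.measure_zero (AddCircle.haarAddCircle : Measure UnitAddCircle)
  rw [ae_iff]
  simpa using this

theorem four_mul_abs_le_norm_one_sub_fourier {x : ℝ} (hx : |x| ≤ 1 / 2) :
    4 * |x| ≤ ‖1 - (fourier 1 (x : UnitAddCircle) : ℂ)‖ := by
  have e : (fourier 1 (x : UnitAddCircle) : ℂ) =
      Complex.exp (Complex.I * ((2 * Real.pi * x : ℝ) : ℂ)) := by
    rw [fourier_coe_apply]
    push_cast
    congr 1
    ring
  rw [e, norm_sub_rev, Complex.norm_exp_I_mul_ofReal_sub_one, norm_mul, Real.norm_eq_abs,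
    Real.norm_eq_abs, abs_two]
  have h1 : |Real.sin (2 * Real.pi * x / 2)| = Real.sin (Real.pi * |x|) := by
    have h2 : 2 * Real.pi * x / 2 = Real.pi * x := by ring
    have h3 : 0 ≤ Real.sin (Real.pi * |x|) :=
      Real.sin_nonneg_of_nonneg_of_le_pi (by positivity) (by nlinarith [Real.pi_pos])
    rw [h2]
    rcases abs_cases x with ⟨h, _⟩ | ⟨h, _⟩
    · rw [h] at h3 ⊢
      exact abs_of_nonneg h3
    · rw [h, mul_neg, Real.sin_neg] at h3 ⊢
      exact abs_of_nonpos (by linarith)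
  have h4 := Real.mul_le_sin (x := Real.pi * |x|) (by positivity) (by nlinarith [Real.pi_pos])
  have h5 : 2 / Real.pi * (Real.pi * |x|) = 2 * |x| := by
    field_simp
  rw [h1]
  linarith

theorem integrable_norm_one_sub_fourier_rpow :
    Integrable (fun θ : UnitAddCircle => ‖1 - (fourier 1 θ : ℂ)‖ ^ (-(1 / 2) : ℝ))
      AddCircle.haarAddCircle := by
  have hm : Measurable fun θ : UnitAddCircle => ‖1 - (fourier 1 θ : ℂ)‖ ^ (-(1 / 2) : ℝ) := by
    have : Measurable fun θ : UnitAddCircle => ‖1 - (fourier 1 θ : ℂ)‖ :=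
      Continuous.measurable (by fun_prop)
    exact this.pow_const _
  rw [← volume_unitAddCircle,
    ← (AddCircle.measurePreserving_mk (1 : ℝ) (-(1 / 2))).integrable_comp hm.aestronglyMeasurable]
  have h1 : IntegrableOn (fun x : ℝ => ‖x‖ ^ (-(1 / 2) : ℝ)) (Metric.ball 0 1) := by
    refine integrableOn_ball_of_norm_le_rpow (C := 1) (α := 1 / 2) (by simp) (by norm_num)
      (Eventually.of_forall fun x => ?_) (measurable_norm.pow_const _).aestronglyMeasurable
    rw [one_mul, Real.norm_of_nonneg (by positivity)]
  have h2 : Set.Ioc (-(1 / 2) : ℝ) (-(1 / 2) + 1) ⊆ Metric.ball 0 1 := by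
    intro x hx
    rw [mem_ball_zero_iff, Real.norm_eq_abs, abs_lt]
    constructor <;> linarith [hx.1, hx.2]
  have hm' : Measurable fun x : ℝ => (x : UnitAddCircle) := AddCircle.measurable_mk'
  refine (h1.mono_set h2).mono' (hm.comp hm').aestronglyMeasurable ?_
  filter_upwards [ae_restrict_mem measurableSet_Ioc, Measure.ae_ne _ (0 : ℝ)] with x hx hx0
  have hx' : |x| ≤ 1 / 2 := by
    rw [abs_le]
    constructor <;> linarith [hx.1, hx.2]
  have h3 := four_mul_abs_le_norm_one_sub_fourier hx'
  have h4 : 0 < |x| := abs_pos.2 hx0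
  rw [Function.comp_apply, Real.norm_of_nonneg (by positivity), Real.norm_eq_abs]
  exact Real.rpow_le_rpow_of_nonpos h4 (by linarith) (by norm_num)

/-- The logarithmic majorant of the boundary values of the map onto the half-strip. -/
noncomputable def stripBound (ζ : ℂ) : ℝ := 1 + 2 * Real.pi + 2 * Real.log (8 / ‖1 - ζ‖)

theorem norm_stripMap_smul_le {ζ : ℂ} (hζ : ‖ζ‖ = 1) (h1 : ζ ≠ 1) {r : ℝ} (h0 : 0 ≤ r)
    (hr : r < 1) : ‖stripMap (r * ζ)‖ ≤ stripBound ζ := by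
  have hz : ‖(r : ℂ) * ζ‖ < 1 := by
    rwa [norm_mul, hζ, mul_one, Complex.norm_real, Real.norm_of_nonneg h0]
  have hζ1 : 0 < ‖1 - ζ‖ := norm_pos_iff.2 (sub_ne_zero.2 h1.symm)
  have h2 : ‖1 - ζ‖ / 2 ≤ ‖1 - r * ζ‖ := by
    have e1 : ‖(r : ℂ) * ζ - ζ‖ = 1 - r := by
      have : (r : ℂ) * ζ - ζ = -(((1 - r : ℝ) : ℂ) * ζ) := by push_cast; ring
      rw [this, norm_neg, norm_mul, hζ, mul_one, Complex.norm_real,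
        Real.norm_of_nonneg (by linarith)]
    have e2 : 1 - r ≤ ‖1 - r * ζ‖ := by
      have := norm_sub_norm_le (1 : ℂ) (r * ζ)
      rwa [norm_one, norm_mul, hζ, mul_one, Complex.norm_real, Real.norm_of_nonneg h0] at this
    have e3 := norm_add_le (1 - r * ζ) (r * ζ - ζ)
    rw [sub_add_sub_cancel, e1] at e3
    linarith
  have h3 := le_norm_halfDiskMap hz
  have hw : 0 < ‖halfDiskMap (r * ζ)‖ := by linarith
  have h4 : |Real.log ‖halfDiskMap (r * ζ)‖| ≤ Real.log (8 / ‖1 - ζ‖) := by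
    rw [abs_of_neg (Real.log_neg hw (norm_halfDiskMap_lt_one hz)), ← Real.log_inv]
    refine Real.log_le_log (inv_pos.2 hw) ?_
    rw [inv_le_comm₀ hw (by positivity), inv_div]
    linarith
  have h5 : ‖Complex.log (halfDiskMap (r * ζ))‖ ≤ Real.log (8 / ‖1 - ζ‖) + Real.pi := by
    refine (Complex.norm_le_abs_re_add_abs_im _).trans ?_
    rw [Complex.log_re, Complex.log_im]
    exact add_le_add h4 (Complex.abs_arg_le_pi _)
  rw [stripMap]
  refine (norm_sub_le _ _).trans ?_
  rw [norm_one, norm_mul, Complex.norm_ofNat, stripBound]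
  linarith

/-- The logarithm is dominated by every power, which makes the majorant `p`-integrable. -/
theorem memLp_stripBound {p : ENNReal} (h0 : p ≠ 0) (hp : p ≠ ⊤) :
    MemLp (fun θ : UnitAddCircle => stripBound (fourier 1 θ)) p AddCircle.haarAddCircle := by
  have hp0 : 0 < p.toReal := ENNReal.toReal_pos h0 hp
  set ε : ℝ := 1 / (2 * p.toReal) with hε
  have hε0 : 0 < ε := by positivity
  have hcont : Measurable fun θ : UnitAddCircle => ‖1 - (fourier 1 θ : ℂ)‖ :=
    Continuous.measurable (by fun_prop)
  have h1 : MemLp (fun θ : UnitAddCircle => ‖1 - (fourier 1 θ : ℂ)‖ ^ (-ε)) p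
      AddCircle.haarAddCircle := by
    rw [← integrable_norm_rpow_iff (hcont.pow_const _).aestronglyMeasurable h0 hp]
    refine integrable_norm_one_sub_fourier_rpow.congr (Eventually.of_forall fun θ => ?_)
    dsimp only
    rw [Real.norm_of_nonneg (by positivity), ← Real.rpow_mul (norm_nonneg _)]
    congr 1
    rw [hε]
    field_simp
  have h2 := (memLp_const (μ := (AddCircle.haarAddCircle : Measure UnitAddCircle)) (p := p)
    (1 + 2 * Real.pi)).add (h1.const_mul (2 * (8 ^ ε / ε)))
  have hmeas : Measurable fun θ : UnitAddCircle => stripBound (fourier 1 θ) :=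
    ((Real.measurable_log.comp (hcont.const_div 8)).const_mul 2).const_add _
  refine h2.mono hmeas.aestronglyMeasurable ?_
  filter_upwards [ae_fourier_one_ne 1] with θ hθ
  have hpos : 0 < ‖1 - (fourier 1 θ : ℂ)‖ := norm_pos_iff.2 (sub_ne_zero.2 hθ.symm)
  have hle : ‖1 - (fourier 1 θ : ℂ)‖ ≤ 2 := by
    refine (norm_sub_le _ _).trans ?_
    rw [norm_one, norm_fourier_one]
    norm_num
  have hlog : 0 ≤ Real.log (8 / ‖1 - (fourier 1 θ : ℂ)‖) := by
    refine Real.log_nonneg ?_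
    rw [le_div_iff₀ hpos]
    linarith
  have hlog2 := Real.log_le_rpow_div (x := 8 / ‖1 - (fourier 1 θ : ℂ)‖) (by positivity) hε0
  rw [Real.div_rpow (by norm_num) hpos.le] at hlog2
  have e : (8 : ℝ) ^ ε / ‖1 - (fourier 1 θ : ℂ)‖ ^ ε / ε =
      8 ^ ε / ε * ‖1 - (fourier 1 θ : ℂ)‖ ^ (-ε) := by
    rw [Real.rpow_neg hpos.le]
    field_simp
  rw [e] at hlog2
  have hpi := Real.pi_pos
  rw [Real.norm_of_nonneg (by rw [stripBound]; positivity), Pi.add_apply,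
    Real.norm_of_nonneg (by positivity), stripBound]
  linarith

/-- An increasing sequence of radii tending to `1`. -/
noncomputable def radius (m : ℕ) : ℝ := 1 - 1 / ((m : ℝ) + 1)

theorem radius_nonneg (m : ℕ) : 0 ≤ radius m := by
  have h : (1 : ℝ) ≤ (m : ℝ) + 1 := by linarith [m.cast_nonneg (α := ℝ)]
  rw [radius, sub_nonneg, div_le_one (by linarith)]
  exact h

theorem radius_lt_one (m : ℕ) : radius m < 1 := by
  have : 0 < 1 / ((m : ℝ) + 1) := by positivity
  rw [radius]
  linarith

theorem tendsto_radius : Tendsto radius atTop (𝓝 1) := by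
  have h := (tendsto_one_div_add_atTop_nhds_zero_nat (𝕜 := ℝ)).const_sub 1
  rwa [sub_zero] at h

theorem tendsto_ofReal_radius : Tendsto (fun m => (radius m : ℂ)) atTop (𝓝 1) :=
  (Complex.continuous_ofReal.tendsto 1).comp tendsto_radius

theorem tendsto_stripMap_radius {ζ : ℂ} (hζ : ‖ζ‖ = 1) (h1 : ζ ≠ 1) (h2 : 1 + ζ ^ 2 ≠ 0) :
    Tendsto (fun m => stripMap (radius m * ζ)) atTop (𝓝 (stripMap ζ)) := by
  have hr : Tendsto (fun m => (radius m : ℂ) * ζ) atTop (𝓝 ζ) := by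
    simpa using tendsto_ofReal_radius.mul_const ζ
  have hw := (differentiableAt_halfDiskMap hζ.le h2).continuousAt.tendsto.comp hr
  have hre : 0 ≤ (halfDiskMap ζ).re :=
    ge_of_tendsto' ((Complex.continuous_re.tendsto _).comp hw) fun m =>
      (halfDiskMap_re_pos (by
        rw [norm_mul, hζ, mul_one, Complex.norm_real, Real.norm_of_nonneg (radius_nonneg m)]
        exact radius_lt_one m)).le
  have hmem : halfDiskMap ζ ∈ Complex.slitPlane := by
    rcases hre.lt_or_eq with h | h
    · exact Or.inl h
    · exact Or.inr fun him => halfDiskMap_ne_zero hζ.le h2 h1 (Complex.ext h.symm him)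
  exact ((hw.clog hmem).const_mul 2).const_sub 1

theorem ae_tendsto_stripMap_radius : ∀ᵐ θ : UnitAddCircle ∂AddCircle.haarAddCircle,
    Tendsto (fun m => stripMap (radius m * fourier 1 θ)) atTop (𝓝 (stripMap (fourier 1 θ))) := by
  filter_upwards [ae_fourier_one_ne 1, ae_fourier_one_ne Complex.I, ae_fourier_one_ne (-Complex.I)]
    with θ h1 h2 h3
  refine tendsto_stripMap_radius (norm_fourier_one θ) h1 fun h => ?_
  have : (fourier 1 θ : ℂ) ^ 2 = Complex.I ^ 2 := by
    rw [Complex.I_sq]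
    linear_combination h
  rcases sq_eq_sq_iff_eq_or_eq_neg.1 this with h | h
  · exact h2 h
  · exact h3 h

theorem aestronglyMeasurable_stripMap_circle :
    AEStronglyMeasurable (fun θ : UnitAddCircle => stripMap (fourier 1 θ))
      AddCircle.haarAddCircle :=
  aestronglyMeasurable_of_tendsto_ae atTop
    (fun m => (continuous_comp_circle differentiableOn_stripMap (radius_nonneg m)
      (radius_lt_one m)).aestronglyMeasurable) ae_tendsto_stripMap_radius

theorem memLp_stripMap_circle {p : ENNReal} (h0 : p ≠ 0) (hp : p ≠ ⊤) :
    MemLp (fun θ : UnitAddCircle => stripMap (fourier 1 θ)) p AddCircle.haarAddCircle := by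
  refine (memLp_stripBound h0 hp).mono aestronglyMeasurable_stripMap_circle ?_
  filter_upwards [ae_tendsto_stripMap_radius, ae_fourier_one_ne 1] with θ hθ h1
  exact (le_of_tendsto' hθ.norm fun m => norm_stripMap_smul_le (norm_fourier_one θ) h1
    (radius_nonneg m) (radius_lt_one m)).trans (le_abs_self _)

/-- By dominated convergence along the radii, the Fourier coefficients of the boundary values are
the Taylor coefficients. -/
theorem fourierCoeff_stripMap_circle (n : ℤ) :
    fourierCoeff (fun θ : UnitAddCircle => stripMap (fourier 1 θ)) n =
      if 0 ≤ n then taylorCoeff stripMap n.toNat else 0 := by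
  have hcont : ∀ m, Continuous fun θ : UnitAddCircle => stripMap (radius m * fourier 1 θ) :=
    fun m => continuous_comp_circle differentiableOn_stripMap (radius_nonneg m) (radius_lt_one m)
  have key := tendsto_integral_of_dominated_convergence
    (F := fun m (θ : UnitAddCircle) => fourier (-n) θ • stripMap (radius m * fourier 1 θ))
    (f := fun θ : UnitAddCircle => fourier (-n) θ • stripMap (fourier 1 θ))
    (fun θ : UnitAddCircle => stripBound (fourier 1 θ))
    (fun m => ((fourier (-n)).continuous.smul (hcont m)).aestronglyMeasurable)
    (memLp_one_iff_integrable.1 (memLp_stripBound one_ne_zero ENNReal.one_ne_top))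
    (fun m => by
      filter_upwards [ae_fourier_one_ne 1] with θ h1
      have : ‖fourier (-n) θ‖ = 1 := by rw [fourier_apply]; exact Circle.norm_coe _
      rw [norm_smul, this, one_mul]
      exact norm_stripMap_smul_le (norm_fourier_one θ) h1 (radius_nonneg m) (radius_lt_one m))
    (by
      filter_upwards [ae_tendsto_stripMap_radius] with θ hθ
      exact hθ.const_smul _)
  refine tendsto_nhds_unique key ?_
  have e : ∀ m, ∫ θ : UnitAddCircle, fourier (-n) θ • stripMap (radius m * fourier 1 θ)
      ∂AddCircle.haarAddCircle =
      if 0 ≤ n then taylorCoeff stripMap n.toNat * (radius m : ℂ) ^ n.toNat else 0 := fun m =>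
    fourierCoeff_circle (fun z hz => hasSum_taylorCoeff differentiableOn_stripMap hz)
      (radius_nonneg m) (radius_lt_one m) n
  simp only [e]
  split_ifs
  · simpa using (tendsto_ofReal_radius.pow n.toNat).const_mul (taylorCoeff stripMap n.toNat)
  · exact tendsto_const_nhds

/-! ### Functions of one variable on the infinite torus -/

theorem integral_fourier (n : ℤ) :
    ∫ θ : UnitAddCircle, (fourier n θ : ℂ) ∂AddCircle.haarAddCircle = if n = 0 then 1 else 0 := by
  have h := congrFun (fourierCoeff_fourier (T := 1) n) 0
  rw [Pi.single_apply] at h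
  simpa [fourierCoeff, eq_comm] using h

namespace InfTorus

/-- The variables are independent, so the Fourier coefficients of a function of `z_p` alone vanish
off the axis of `p`. -/
theorem fourierCoeff_comp_eval {F : UnitAddCircle → ℂ}
    (hF : AEStronglyMeasurable F AddCircle.haarAddCircle) (p : Nat.Primes) (α : Nat.Primes →₀ ℤ) :
    fourierCoeff (fun z => F (z p)) α =
      if α = Finsupp.single p (α p) then _root_.fourierCoeff F (α p) else 0 := by
  classical
  set S : Finset Nat.Primes := insert p α.support with hS
  have hpS : p ∈ S := Finset.mem_insert_self _ _
  set g : Nat.Primes → UnitAddCircle → ℂ := fun q θ =>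
    (if q = p then F θ else 1) * fourier (-(α q)) θ with hg
  have hgm : ∀ q, AEStronglyMeasurable (g q) AddCircle.haarAddCircle := by
    intro q
    refine AEStronglyMeasurable.mul ?_ (fourier (-(α q))).continuous.aestronglyMeasurable
    by_cases h : q = p
    · simpa [h] using hF
    · simpa [h] using aestronglyMeasurable_const
  have hint : ∀ z : InfTorus, F (z p) * character (-α) z = ∏ q : S, g q (z q) := by
    intro z
    have h1 : character (-α) z = ∏ q ∈ S, (fourier (-(α q)) (z q) : ℂ) := by
      rw [character, Finsupp.prod_of_support_subset (s := S)]
      · rfl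
      · intro q hq
        rw [Finsupp.support_neg] at hq
        exact Finset.mem_insert_of_mem hq
      · intro q _
        simp
    have h2 : ∏ q ∈ S, (if q = p then F (z q) else 1) = F (z p) := by
      rw [Finset.prod_ite_eq' S p fun q => F (z q), if_pos hpS]
    rw [Finset.prod_coe_sort S fun q => g q (z q), h1, ← h2, ← Finset.prod_mul_distrib]
  have hind : ProbabilityTheory.iIndepFun (fun (q : S) (z : InfTorus) => z q) haar :=
    (ProbabilityTheory.iIndepFun_infinitePi (P := fun _ : Nat.Primes => AddCircle.haarAddCircle)
      (X := fun _ θ => θ) fun _ => measurable_id).precomp Subtype.val_injective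
  have hmap : ∀ q : Nat.Primes, haar.map (fun z : InfTorus => z q) = AddCircle.haarAddCircle :=
    fun q => Measure.infinitePi_map_eval _ q
  have hprod : fourierCoeff (fun z => F (z p)) α =
      ∏ q ∈ S, ∫ θ, g q θ ∂AddCircle.haarAddCircle := by
    rw [fourierCoeff, integral_congr_ae (Eventually.of_forall hint),
      hind.integral_fun_prod_comp (fun q => (measurable_pi_apply _).aemeasurable)
        (fun q => by rw [hmap]; exact hgm q),
      ← Finset.prod_coe_sort S fun q => ∫ θ, g q θ ∂AddCircle.haarAddCircle]
    refine Finset.prod_congr rfl fun q _ => ?_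
    rw [← hmap q, integral_map (measurable_pi_apply _).aemeasurable (by rw [hmap]; exact hgm q)]
  have hgp : ∫ θ, g p θ ∂AddCircle.haarAddCircle = _root_.fourierCoeff F (α p) := by
    simp [hg, _root_.fourierCoeff, mul_comm]
  have hgq : ∀ q, q ≠ p → ∫ θ, g q θ ∂AddCircle.haarAddCircle = if α q = 0 then 1 else 0 := by
    intro q hq
    simp only [hg, if_neg hq, one_mul, integral_fourier, neg_eq_zero]
  rw [hprod]
  split_ifs with h
  · rw [Finset.prod_eq_single_of_mem p hpS, hgp]
    intro q _ hq
    have : α q = 0 := by rw [h, Finsupp.single_eq_of_ne hq]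
    rw [hgq q hq, if_pos this]
  · obtain ⟨q, hq, hq0⟩ : ∃ q, q ≠ p ∧ α q ≠ 0 := by
      by_contra! hcon
      refine h (Finsupp.ext fun q => ?_)
      rcases eq_or_ne q p with rfl | hq
      · simp
      · rw [hcon q hq, Finsupp.single_eq_of_ne hq]
    refine Finset.prod_eq_zero (i := q)
      (Finset.mem_insert_of_mem (Finsupp.mem_support_iff.2 hq0)) ?_
    rw [hgq q hq, if_neg hq0]

end InfTorus

/-! ### Dirichlet series in powers of `2^{-s}` -/

/-- The prime `2`. -/
def primeTwo : Nat.Primes := ⟨2, Nat.prime_two⟩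

/-- The coefficients of the Dirichlet series `∑ c_k 2^{-ks}`. -/
noncomputable def twoPowCoeff (c : ℕ → ℂ) : ℕ+ → ℂ :=
  Function.extend (fun k : ℕ => (2 : ℕ+) ^ k) c 0

theorem two_pow_injective : Function.Injective fun k : ℕ => (2 : ℕ+) ^ k := by
  intro j k h
  have := congrArg PNat.val h
  simp only [PNat.pow_coe] at this
  exact Nat.pow_right_injective le_rfl this

theorem twoPowCoeff_two_pow (c : ℕ → ℂ) (k : ℕ) : twoPowCoeff c (2 ^ k) = c k :=
  two_pow_injective.extend_apply c 0 k

theorem twoPowCoeff_bohrIndex (c : ℕ → ℂ) (α : Nat.Primes →₀ ℕ) :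
    twoPowCoeff c (bohrIndex α) =
      if α = Finsupp.single primeTwo (α primeTwo) then
        c (α primeTwo) else 0 := by
  split_ifs with h
  · have : bohrIndex α = 2 ^ α primeTwo := by
      rw [bohrIndex]
      conv_lhs => rw [h]
      exact Finsupp.prod_single_index (h := fun (p : Nat.Primes) k => (p : ℕ+) ^ k) (pow_zero _)
    rw [this, twoPowCoeff_two_pow]
  · obtain ⟨q, hq, hq0⟩ : ∃ q : Nat.Primes, q ≠ primeTwo ∧ α q ≠ 0 := by
      by_contra! hcon
      refine h (Finsupp.ext fun q => ?_)
      rcases eq_or_ne q primeTwo with rfl | hq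
      · simp
      · rw [hcon q hq, Finsupp.single_eq_of_ne hq]
    rw [twoPowCoeff, Function.extend_apply', Pi.zero_apply]
    rintro ⟨k, hk⟩
    -- the odd prime `q` divides the integer indexed by `α`
    have hdvd : ((q : ℕ+)) ∣ bohrIndex α :=
      (dvd_pow_self _ hq0).trans
        (Finset.dvd_prod_of_mem (fun p : Nat.Primes => (p : ℕ+) ^ α p)
          (Finsupp.mem_support_iff.2 hq0))
    rw [← hk, PNat.dvd_iff, PNat.pow_coe] at hdvd
    have h1 : (q : ℕ) ∣ 2 := q.2.dvd_of_dvd_pow hdvd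
    exact hq (Subtype.ext ((Nat.prime_dvd_prime_iff_eq q.2 Nat.prime_two).1 h1))

theorem hasDirichletSeries_stripSeries :
    HasDirichletSeries stripSeries (twoPowCoeff (taylorCoeff stripMap)) := by
  refine ⟨fun s hs => ?_, 0, fun s hs _ => ?_⟩
  · have h1 : DifferentiableAt ℂ stripMap (2 ^ (-s)) :=
      differentiableOn_stripMap.differentiableAt
        (Metric.isOpen_ball.mem_nhds (by simpa using norm_two_cpow_neg_lt hs))
    have h2 : DifferentiableAt ℂ (fun s : ℂ => (2 : ℂ) ^ (-s)) s :=
      (differentiableAt_id.neg).const_cpow (Or.inl two_ne_zero)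
    exact (h1.comp s h2).differentiableWithinAt
  · rw [← two_pow_injective.hasSum_iff]
    · refine (hasSum_taylorCoeff differentiableOn_stripMap (norm_two_cpow_neg_lt hs)).congr_fun
        fun k => ?_
      rw [Function.comp_apply, dirichletTerm, twoPowCoeff_two_pow, two_pow_cpow_neg]
    · intro n hn
      rw [dirichletTerm, twoPowCoeff, Function.extend_apply' _ _ _ hn, Pi.zero_apply, zero_mul]

theorem memDirichletHardy_stripSeries {p : ENNReal} (h0 : p ≠ 0) (hp : p ≠ ⊤) :
    MemDirichletHardy stripSeries p := by
  have hc := InfTorus.fourierCoeff_comp_eval aestronglyMeasurable_stripMap_circle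
    primeTwo
  refine ⟨_, hasDirichletSeries_stripSeries,
    fun z => stripMap (fourier 1 (z primeTwo)), ⟨?_, fun α hα => ?_⟩, fun α => ?_⟩
  · exact (memLp_stripMap_circle h0 hp).comp_measurePreserving
      (measurePreserving_eval_infinitePi _ _)
  · rw [hc]
    split_ifs with h
    · obtain ⟨q, hq⟩ := hα
      rcases eq_or_ne q primeTwo with rfl | hq2
      · rw [fourierCoeff_stripMap_circle, if_neg hq.not_ge]
      · rw [h, Finsupp.single_eq_of_ne hq2] at hq
        exact absurd hq (lt_irrefl 0)
    · rfl
  · rw [hc, twoPowCoeff_bohrIndex]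
    have hiff : α.mapRange Nat.cast (Nat.cast_zero (R := ℤ)) =
        Finsupp.single primeTwo ((α primeTwo : ℕ) : ℤ) ↔
        α = Finsupp.single primeTwo (α primeTwo) := by
      rw [← Finsupp.mapRange_single (hf := Nat.cast_zero)]
      exact (Finsupp.mapRange_injective _ Nat.cast_zero Nat.cast_injective).eq_iff
    simp only [Finsupp.mapRange_apply, hiff, fourierCoeff_stripMap_circle, Int.natCast_nonneg,
      if_true, Int.toNat_natCast]

theorem theorem1 :
    ∃ (φ f : ℂ → ℂ) (hφ : Set.MapsTo φ (rightHalfPlane 0) (rightHalfPlane 0))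
      (C : WienerAlgebra →L[ℂ] WienerAlgebra),
      IsConvergentDirichletSeries φ ∧
      IsConformalMapOnto f (Metric.ball 0 1) halfStrip ∧
      (∀ s ∈ rightHalfPlane 0, φ s = f ((2 : ℂ) ^ (-s))) ∧
      IsCompositionOperator φ hφ C ∧
      (rightHalfPlane 0).domRestrict φ ∉ wienerSubmodule ∧
      (∀ p : ENNReal, 1 ≤ p → p ≠ ⊤ → MemDirichletHardy φ p) ∧
      IsCompactOperator C ∧
      IsAbsolutelySumming C := by
  obtain ⟨C, hC, hcpt, hsum⟩ := exists_compositionOperator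
  exact ⟨stripSeries, stripMap, mapsTo_stripSeries, C, ⟨_, hasDirichletSeries_stripSeries⟩,
    isConformalMapOnto_stripMap, fun _ _ => rfl, hC, stripSeries_notMem_wiener,
    fun p h1 hp => memDirichletHardy_stripSeries (one_pos.trans_le h1).ne' hp, hcpt, hsum⟩
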